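/- **Lemma 3.3.** Let $N\ge 1$, let $\Omega\subset\mathbb R^N$ be a bounded connected open set, $T>0$, $Q=\Omega\times{]0,T[}$, $Y=(-\frac12,\frac12)^N$ and $Z=(-\frac12,\frac12)$; all functions are real-valued. Let $a_{ij}\in L^\infty(\mathbb R^N)$ ($1\le i,j\le N$) be $Y$-periodic with $a_{ij}=a_{ji}$, and suppose that for some $\alpha>0$, $\sum_{i,j}a_{ij}(y)\zeta_j\zeta_i\ge\alpha|\zeta|^2$ for all $\zeta\in\mathbb R^N$ and almost all $y\in\mathbb R^N$. Let $\mathbf f\in L^2(0,T;H^{-1}(\Omega)^N)$. *Spaces.* $V=\{\mathbf u\in H^1_0(\Omega)^N:\operatorname{div}\mathbf u=0\}$, with dual $V'$; $\mathcal W(0,T)=\{\mathbf u\in L^2(0,T;V):\mathbf u'\in L^2(0,T;V')\}$, which is contained in $\mathcal C([0,T];L^2(\Omega)^N)$; $L^2(\Omega)/\mathbb R=\{v\in L^2(\Omega):\int_\Omega v\,dx=0\}$. $V_Y$ is the space of vector fields $\mathbf w=(w^k)$ whose components are $Y$-periodic functions in $H^1_{loc}(\mathbb R^N)$ of mean zero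 over $Y$, with $\operatorname{div}_y\mathbf w=0$; $L^2_{per}(Z;V_Y)$ is the space of $Z$-periodic $V_Y$-valued functions that are square integrable on $Z$. *Homogenized coefficients.* For $1\le i,k\le N$ let $\boldsymbol\chi_{ik}=(\chi_{ik}^r)_{1\le r\le N}\in L^2_{per}(Z;V_Y)$ be the unique solution of $$\sum_{l,j,r=1}^N\iint_{Y\times Z}a_{lj}\frac{\partial\chi_{ik}^r}{\partial y_j}\frac{\partial w^r}{\partial y_l}\,dy\,d\tau=\sum_{l=1}^N\iint_{Y\times Z}a_{li}\frac{\partial w^k}{\partial y_l}\,dy\,d\tau\qquad\text{for all }\mathbf w\in L^2_{per}(Z;V_Y),$$ and for $1\le i,j,k,h\le N$ put $$q_{ijkh}=\delta_{kh}\int_Y a_{ij}\,dy-\sum_{l=1}^N\iint_{Y\times Z}a_{il}\frac{\partial\chi^k_{jh}}{\partial y_l}\,dy\,d\tau,\qquad(\mathcal Q\mathbf z)^k=-\sum_{i,j,h=1}^N q_{ijkh}\frac{\partial^2z^h}{\partial x_i\partial x_j}.$$ *Claim.* The homogenized initial boundary value problem $$\frac{\partial\mathbf u_0}{\partial t}+\mathcal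 Q\mathbf u_0+\mathbf{grad}\,p_0=\mathbf f\ \text{ in }Q,\qquad\operatorname{div}\mathbf u_0=0\ \text{ in }Q,\qquad\mathbf u_0=0\ \text{ on }\partial\Omega\times{]0,T[},\qquad\mathbf u_0(0)=0\ \text{ in }\Omega,$$ has at most one weak solution $(\mathbf u_0,p_0)$ with $\mathbf u_0\in\mathcal W(0,T)$ and $p_0\in L^2(0,T;L^2(\Omega)/\mathbb R)$. Here $(\mathbf u_0,p_0)$ is called a weak solution if the first equation holds in the sense of distributions on $Q$, that is, for all $\boldsymbol\psi=(\psi^k)\in\mathcal D(Q)^N$, $$-\int_Q\mathbf u_0\cdot\frac{\partial\boldsymbol\psi}{\partial t}\,dx\,dt+\sum_{i,j,k,h=1}^N\int_Q q_{ijkh}\frac{\partial u_0^h}{\partial x_j}\frac{\partial\psi^k}{\partial x_i}\,dx\,dt-\int_Q p_0\operatorname{div}\boldsymbol\psi\,dx\,dt=\int_0^T\langle\mathbf f(t),\boldsymbol\psi(t)\rangle\,dt,$$ and $\mathbf u_0(0)=0$ (the second and third equations are contained in $\mathbf u_0(t)\in V$). -/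

import Mathlib

open MeasureTheory Set TopologicalSpace
open scoped Distributions ENNReal ContDiff

namespace StokesHom

noncomputable section

/-- The numerical space `ℝ^N`, with its Euclidean norm and Lebesgue measure. -/
abbrev E (N : ℕ) : Type := EuclideanSpace ℝ (Fin N)

/-- The `i`-th vector of the canonical basis of `ℝ^N`. -/
abbrev e {N : ℕ} (i : Fin N) : E N := EuclideanSpace.single i (1 : ℝ)

/-- Real `L²(A)` for a subset `A` of `ℝ^N` (Lebesgue measure). -/
abbrev L2 {N : ℕ} (A : Set (E N)) : Type := Lp ℝ 2 (volume.restrict A)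

/-- `L²(A) × L²(A)^N` with its Hilbert norm. An element `U` is meant to be a function together with
its gradient: `U none` is the function and `U (some i)` is its `i`-th partial derivative. Hence the
norm is the full `H¹` norm (on `H₀¹` of a bounded open set and on periodic functions of mean zero,
it is equivalent to the `L²` norm of the gradient). -/
abbrev H1Amb {N : ℕ} (A : Set (E N)) : Type := PiLp 2 (fun _ : Option (Fin N) => L2 A)

/-! ### The space `H₀¹(Ω)` and the solenoidal space `V` -/

section Dirichlet

variable {N : ℕ}

/-- A test function and its partial derivatives; the components of the pair `(φ, ∇φ)`. -/
def testComp (φ : E N → ℝ) : Option (Fin N) → E N → ℝ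
  | none => φ
  | some i => fun x => fderiv ℝ φ x (e i)

theorem testComp_memLp {Ω : Opens (E N)} (φ : 𝓓(Ω, ℝ)) (o : Option (Fin N)) :
    MemLp (testComp (φ : E N → ℝ) o) 2 (volume.restrict (Ω : Set (E N))) := by
  refine MemLp.restrict _ ?_
  cases o with
  | none => exact φ.continuous.memLp_of_hasCompactSupport φ.hasCompactSupport
  | some i =>
    refine Continuous.memLp_of_hasCompactSupport ?_ ?_
    · exact (φ.contDiff.continuous_fderiv (by simp)).clm_apply continuous_const
    · exact φ.hasCompactSupport.fderiv_apply ℝ (e i)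

/-- The linear map `φ ↦ (φ, ∇φ)` from `𝓓(Ω)` to `L²(Ω) × L²(Ω)^N`. -/
def testGraph (Ω : Opens (E N)) : 𝓓(Ω, ℝ) →ₗ[ℝ] H1Amb (Ω : Set (E N)) where
  toFun φ := WithLp.toLp 2 fun o => (testComp_memLp φ o).toLp
  map_add' φ ψ := by
    ext1 o
    change (testComp_memLp (φ + ψ) o).toLp =
      (testComp_memLp φ o).toLp + (testComp_memLp ψ o).toLp
    rw [← MemLp.toLp_add, MemLp.toLp_eq_toLp_iff]
    refine Filter.Eventually.of_forall fun x => ?_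
    cases o with
    | none => rfl
    | some i =>
      have h1 : DifferentiableAt ℝ (φ : E N → ℝ) x := (φ.contDiff.differentiable (by simp)) x
      have h2 : DifferentiableAt ℝ (ψ : E N → ℝ) x := (ψ.contDiff.differentiable (by simp)) x
      change fderiv ℝ ((φ : E N → ℝ) + (ψ : E N → ℝ)) x (e i) = _
      rw [fderiv_add h1 h2]
      rfl
  map_smul' c φ := by
    ext1 o
    change (testComp_memLp (c • φ) o).toLp = c • (testComp_memLp φ o).toLp
    rw [← MemLp.toLp_const_smul, MemLp.toLp_eq_toLp_iff]
    refine Filter.Eventually.of_forall fun x => ?_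
    cases o with
    | none => rfl
    | some i =>
      have h1 : DifferentiableAt ℝ (φ : E N → ℝ) x := (φ.contDiff.differentiable (by simp)) x
      change fderiv ℝ (c • (φ : E N → ℝ)) x (e i) = _
      rw [fderiv_const_smul h1]
      rfl

/-- `H₀¹(Ω; ℝ)`: the closure of `𝓓(Ω)` in the `H¹` norm. -/
def H10 (Ω : Opens (E N)) : Submodule ℝ (H1Amb (Ω : Set (E N))) :=
  (LinearMap.range (testGraph Ω)).topologicalClosure

/-- A test function as an element of `H₀¹(Ω)`. -/
def testH10 {Ω : Opens (E N)} (φ : 𝓓(Ω, ℝ)) : H10 Ω :=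
  ⟨testGraph Ω φ, Submodule.le_topologicalClosure _ ⟨φ, rfl⟩⟩

/-- `H₀¹(Ω; ℝ)^N`. -/
abbrev H10N (Ω : Opens (E N)) : Type := PiLp 2 (fun _ : Fin N => H10 Ω)

instance instNormedAddCommGroupH10N (Ω : Opens (E N)) : NormedAddCommGroup (H10N Ω) :=
  PiLp.normedAddCommGroup 2 _

instance instInnerProductSpaceH10N (Ω : Opens (E N)) :
    InnerProductSpace ℝ (H10N Ω) := PiLp.innerProductSpace _

instance instNormedSpaceH10N (Ω : Opens (E N)) : NormedSpace ℝ (H10N Ω) :=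
  InnerProductSpace.toNormedSpace

/-- `H⁻¹(Ω; ℝ)^N`, the topological dual of `H₀¹(Ω; ℝ)^N`. -/
abbrev Hneg1N (Ω : Opens (E N)) : Type := StrongDual ℝ (H10N Ω)

/-- The component `u^k ∈ L²(Ω)` of `u ∈ H₀¹(Ω)^N`. -/
def comp {Ω : Opens (E N)} (u : H10N Ω) (k : Fin N) : L2 (Ω : Set (E N)) :=
  (u k : H1Amb (Ω : Set (E N))) none

/-- The partial derivative `∂u^k/∂x_j ∈ L²(Ω)` of `u ∈ H₀¹(Ω)^N`. -/
def pd {Ω : Opens (E N)} (u : H10N Ω) (k j : Fin N) : L2 (Ω : Set (E N)) :=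
  (u k : H1Amb (Ω : Set (E N))) (some j)

/-- `V = {u ∈ H₀¹(Ω; ℝ)^N : div u = 0}`. -/
def V (Ω : Opens (E N)) : Submodule ℝ (H10N Ω) where
  carrier := {u | ∑ k, pd u k k = 0}
  add_mem' {u v} hu hv := by
    have h : ∀ k, pd (u + v) k k = pd u k k + pd v k k := fun _ => rfl
    simp only [mem_ofPred_eq] at hu hv ⊢
    simp [h, Finset.sum_add_distrib, hu, hv]
  zero_mem' := by
    have h : ∀ k, pd (0 : H10N Ω) k k = 0 := fun _ => rfl
    simp [h]
  smul_mem' c u hu := by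
    have h : ∀ k, pd (c • u) k k = c • pd u k k := fun _ => rfl
    simp only [mem_ofPred_eq] at hu ⊢
    simp [h, ← Finset.smul_sum, hu]

instance instNormedAddCommGroupV (Ω : Opens (E N)) : NormedAddCommGroup (V Ω) :=
  Submodule.normedAddCommGroup _

instance instInnerProductSpaceV (Ω : Opens (E N)) :
    InnerProductSpace ℝ (V Ω) := Submodule.innerProductSpace _

instance instNormedSpaceV (Ω : Opens (E N)) : NormedSpace ℝ (V Ω) :=
  InnerProductSpace.toNormedSpace

/-- The topological dual `V'` of `V`. -/
abbrev Vdual (Ω : Opens (E N)) : Type := StrongDual ℝ (V Ω)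

/-- `L²(Ω; ℝ)/ℝ = {v ∈ L²(Ω; ℝ) : ∫_Ω v dx = 0}` (integrability is automatic when `Ω` is
bounded). -/
def L2mod (Ω : Opens (E N)) : Submodule ℝ (L2 (Ω : Set (E N))) where
  carrier := {v | Integrable v (volume.restrict (Ω : Set (E N))) ∧
    ∫ x in (Ω : Set (E N)), v x = 0}
  add_mem' {u v} hu hv := by
    refine ⟨(hu.1.add hv.1).congr (Lp.coeFn_add u v).symm, ?_⟩
    rw [integral_congr_ae (Lp.coeFn_add u v)]
    simp only [Pi.add_apply]
    rw [integral_add hu.1 hv.1, hu.2, hv.2, add_zero]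
  zero_mem' := by
    refine ⟨(integrable_zero _ _ _).congr (Lp.coeFn_zero _ _ _).symm, ?_⟩
    rw [integral_congr_ae (Lp.coeFn_zero _ _ _)]
    simp
  smul_mem' c u hu := by
    refine ⟨(hu.1.smul c).congr (Lp.coeFn_smul c u).symm, ?_⟩
    rw [integral_congr_ae (Lp.coeFn_smul c u)]
    simp only [Pi.smul_apply]
    rw [integral_smul, hu.2, smul_zero]

end Dirichlet

/-! ### Bochner spaces in time and the space `W(0,T)` -/

section Time

variable {N : ℕ}

/-- `L²(0,T;X)`. -/
abbrev L2T (T : ℝ) (X : Type) [NormedAddCommGroup X] : Type :=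
  Lp X 2 (volume.restrict (Ioo (0 : ℝ) T))

/-- The open interval `]0,T[` as a bundled open set. -/
def timeInterval (T : ℝ) : Opens ℝ := ⟨Ioo 0 T, isOpen_Ioo⟩

/-- `u' ∈ L²(0,T;V')` is the derivative of `u ∈ L²(0,T;V)` in the sense of distributions on
`]0,T[`, where `V` is embedded in `V'` by means of the inner product of `L²(Ω)^N`. -/
def HasTimeDeriv (Ω : Opens (E N)) (T : ℝ) (u : L2T T (V Ω)) (u' : L2T T (Vdual Ω)) :
    Prop :=
  ∀ (v : V Ω) (φ : 𝓓(timeInterval T, ℝ)),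
    ∫ t in Ioo 0 T, deriv φ t * ∑ k, inner ℝ (comp (u t : H10N Ω) k) (comp (v : H10N Ω) k) =
      -∫ t in Ioo 0 T, φ t * u' t v

/-- `W(0,T) = {u ∈ L²(0,T;V) : u' ∈ L²(0,T;V')}`. -/
def W (Ω : Opens (E N)) (T : ℝ) : Set (L2T T (V Ω)) :=
  {u | ∃ u' : L2T T (Vdual Ω), HasTimeDeriv Ω T u u'}

/-- `u(0) = 0`: the continuous representative `[0,T] → L²(Ω)^N` of `u` vanishes at time `0`. -/
def VanishesAtZero (Ω : Opens (E N)) (T : ℝ) (u : L2T T (V Ω)) : Prop :=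
  ∃ w : ℝ → Fin N → L2 (Ω : Set (E N)), ContinuousOn w (Icc 0 T) ∧
    (∀ᵐ t ∂(volume.restrict (Ioo 0 T)), ∀ k, w t k = comp (u t : H10N Ω) k) ∧ w 0 = 0

/-- The cylinder `Q = Ω × ]0,T[`; its points are written `(x, t)`. -/
def cylinder (Ω : Opens (E N)) (T : ℝ) : Opens (E N × ℝ) :=
  ⟨(Ω : Set (E N)) ×ˢ Ioo 0 T, Ω.isOpen.prod isOpen_Ioo⟩

/-- For `ψ ∈ 𝓓(Q)^N`, the scalar test function `x ↦ ψ^k(x, t)` in `𝓓(Ω)`. -/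
def slice {Ω : Opens (E N)} {T : ℝ} (ψ : 𝓓(cylinder Ω T, E N)) (t : ℝ) (k : Fin N) :
    𝓓(Ω, ℝ) where
  toFun x := ψ (x, t) k
  contDiff' := by
    have h : ContDiff ℝ ((⊤ : ℕ∞) : WithTop ℕ∞) fun x : E N => ψ (x, t) :=
      ψ.contDiff.comp (contDiff_id.prodMk contDiff_const)
    exact (contDiff_piLp 2).1 h k
  hasCompactSupport' := by
    refine HasCompactSupport.intro (ψ.hasCompactSupport.isCompact.image continuous_fst) ?_
    intro x hx
    have h0 : ψ (x, t) = 0 := by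
      by_contra h
      exact hx ⟨(x, t), subset_tsupport _ h, rfl⟩
    simp [h0]
  tsupport_subset' := by
    have hcl : IsClosed {x : E N | (x, t) ∈ tsupport (ψ : E N × ℝ → E N)} :=
      (isClosed_tsupport _).preimage (by fun_prop)
    have hsub : tsupport (fun x : E N => ψ (x, t) k) ⊆
        {x : E N | (x, t) ∈ tsupport (ψ : E N × ℝ → E N)} := by
      refine closure_minimal ?_ hcl
      intro x hx
      refine subset_tsupport _ ?_
      intro h0
      apply hx
      simp [h0]
    intro x hx
    exact (ψ.tsupport_subset (hsub hx)).1

/-- For `ψ ∈ 𝓓(Q)^N`, the function `ψ(t) = ψ(·, t)` as an element of `H₀¹(Ω)^N`. -/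
def sliceH10N {Ω : Opens (E N)} {T : ℝ} (ψ : 𝓓(cylinder Ω T, E N)) (t : ℝ) : H10N Ω :=
  WithLp.toLp 2 fun k => testH10 (slice ψ t k)

end Time

/-! ### Periodic functions, correctors and homogenized coefficients -/

section Periodic

variable {N : ℕ}

/-- The reference cell `Y = (-1/2, 1/2)^N`. -/
def cellY (N : ℕ) : Set (E N) := {y | ∀ i, y i ∈ Ioo (-(1 / 2) : ℝ) (1 / 2)}

/-- The reference cell `Z = (-1/2, 1/2)`. -/
def cellZ : Set ℝ := Ioo (-(1 / 2) : ℝ) (1 / 2)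

/-- `u(y + k) = u(y)` for almost every `y`, for each `k ∈ ℤ^N`. -/
def IsYPeriodic (u : E N → ℝ) : Prop :=
  ∀ k : Fin N → ℤ, ∀ᵐ y : E N, u (y + WithLp.toLp 2 fun i => (k i : ℝ)) = u y

/-- `u ∈ L²_loc(ℝ^N)`. -/
def IsL2loc (u : E N → ℝ) : Prop :=
  ∀ K : Set (E N), IsCompact K → MemLp u 2 (volume.restrict K)

/-- `∂u/∂y_i = g` in the sense of distributions on `ℝ^N`. -/
def HasWeakPartial (u g : E N → ℝ) (i : Fin N) : Prop :=
  ∀ φ : 𝓓((⊤ : Opens (E N)), ℝ),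
    ∫ y, u y * fderiv ℝ φ y (e i) = -∫ y, g y * φ y

theorem IsL2loc.add {u v : E N → ℝ} (hu : IsL2loc u) (hv : IsL2loc v) : IsL2loc (u + v) :=
  fun K hK => (hu K hK).add (hv K hK)

theorem IsL2loc.smul {u : E N → ℝ} (hu : IsL2loc u) (c : ℝ) : IsL2loc (c • u) :=
  fun K hK => (hu K hK).const_smul c

theorem IsL2loc.zero : IsL2loc (0 : E N → ℝ) := fun _ _ => MemLp.zero

theorem IsL2loc.locallyIntegrable {u : E N → ℝ} (hu : IsL2loc u) : LocallyIntegrable u volume := by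
  rw [locallyIntegrable_iff]
  intro K hK
  have : IsFiniteMeasure (volume.restrict K) := ⟨by simpa using hK.measure_lt_top⟩
  exact (hu K hK).integrable one_le_two

theorem IsL2loc.integrable_mul {u : E N → ℝ} (hu : IsL2loc u) {g : E N → ℝ} (hg : Continuous g)
    (hc : HasCompactSupport g) : Integrable (fun y => u y * g y) volume := by
  have h := hu.locallyIntegrable.integrable_smul_left_of_hasCompactSupport hg hc
  refine h.congr (Filter.Eventually.of_forall fun y => ?_)
  simp [mul_comm]

theorem HasWeakPartial.add {u v g h : E N → ℝ} {i : Fin N} (hu : IsL2loc u) (hv : IsL2loc v)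
    (hg : IsL2loc g) (hh : IsL2loc h) (h1 : HasWeakPartial u g i) (h2 : HasWeakPartial v h i) :
    HasWeakPartial (u + v) (g + h) i := by
  intro φ
  have hd : Continuous fun y => fderiv ℝ (φ : E N → ℝ) y (e i) :=
    (φ.contDiff.continuous_fderiv (by simp)).clm_apply continuous_const
  have hdc : HasCompactSupport fun y => fderiv ℝ (φ : E N → ℝ) y (e i) :=
    φ.hasCompactSupport.fderiv_apply ℝ (e i)
  simp only [Pi.add_apply, add_mul]
  rw [integral_add (hu.integrable_mul hd hdc) (hv.integrable_mul hd hdc),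
    integral_add (hg.integrable_mul φ.continuous φ.hasCompactSupport)
      (hh.integrable_mul φ.continuous φ.hasCompactSupport), h1 φ, h2 φ]
  ring

theorem HasWeakPartial.smul {u g : E N → ℝ} {i : Fin N} (h : HasWeakPartial u g i) (c : ℝ) :
    HasWeakPartial (c • u) (c • g) i := by
  intro φ
  simp only [Pi.smul_apply, smul_eq_mul, mul_assoc]
  rw [integral_const_mul, integral_const_mul, h φ]
  ring

theorem HasWeakPartial.zero (i : Fin N) : HasWeakPartial (0 : E N → ℝ) 0 i := by
  intro φ
  simp

/-- `ũ` is a `Y`-periodic function in `H¹_loc(ℝ^N)` whose restriction to `Y` is `U none` and whose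
`i`-th weak partial derivative is, on `Y`, `U (some i)`. -/
def IsPeriodicExtension (U : H1Amb (cellY N)) (ũ : E N → ℝ) : Prop :=
  IsYPeriodic ũ ∧ IsL2loc ũ ∧ U none =ᵐ[volume.restrict (cellY N)] ũ ∧
    ∀ i, ∃ g : E N → ℝ, IsL2loc g ∧ HasWeakPartial ũ g i ∧
      U (some i) =ᵐ[volume.restrict (cellY N)] g

theorem integrable_cellY (u : L2 (cellY N)) : Integrable u (volume.restrict (cellY N)) := by
  have hb : Bornology.IsBounded (cellY N) := by
    refine (Metric.isBounded_closedBall (x := (0 : E N)) (r := Real.sqrt (∑ _i : Fin N, 1))).subset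
      fun y hy => ?_
    rw [mem_closedBall_zero_iff, EuclideanSpace.norm_eq]
    refine Real.sqrt_le_sqrt (Finset.sum_le_sum fun i _ => ?_)
    have h := hy i
    rw [Real.norm_eq_abs, sq_abs]
    nlinarith [h.1, h.2]
  have : IsFiniteMeasure (volume.restrict (cellY N)) := ⟨by simpa using hb.measure_lt_top⟩
  exact (Lp.memLp u).integrable one_le_two

/-- `H¹_#(Y; ℝ)`: the `Y`-periodic functions in `H¹_loc(ℝ^N)` with `∫_Y u dy = 0`. Such a function
is identified with its restriction to `Y`. -/
def H1per (N : ℕ) : Submodule ℝ (H1Amb (cellY N)) where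
  carrier := {U | (∃ ũ, IsPeriodicExtension U ũ) ∧ ∫ y in cellY N, U none y = 0}
  add_mem' := by
    rintro U U' ⟨⟨u, hp, hl, he, hg⟩, hm⟩ ⟨⟨u', hp', hl', he', hg'⟩, hm'⟩
    refine ⟨⟨u + u', fun k => ?_, hl.add hl', ?_, fun i => ?_⟩, ?_⟩
    · filter_upwards [hp k, hp' k] with y h h'
      simp [h, h']
    · exact (Lp.coeFn_add (U none) (U' none)).trans (he.add he')
    · obtain ⟨g, h1, h2, h3⟩ := hg i
      obtain ⟨g', h1', h2', h3'⟩ := hg' i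
      exact ⟨g + g', h1.add h1', h2.add hl hl' h1 h1' h2',
        (Lp.coeFn_add (U (some i)) (U' (some i))).trans (h3.add h3')⟩
    · change ∫ y in cellY N, (U none + U' none : L2 (cellY N)) y = 0
      rw [integral_congr_ae (Lp.coeFn_add (U none) (U' none))]
      simp only [Pi.add_apply]
      rw [integral_add (integrable_cellY _) (integrable_cellY _), hm, hm', add_zero]
  zero_mem' := by
    refine ⟨⟨0, fun k => by simp, IsL2loc.zero, Lp.coeFn_zero _ _ _, fun i =>
      ⟨0, IsL2loc.zero, HasWeakPartial.zero i, Lp.coeFn_zero _ _ _⟩⟩, ?_⟩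
    change ∫ y in cellY N, (0 : L2 (cellY N)) y = 0
    rw [integral_congr_ae (Lp.coeFn_zero _ _ _)]
    simp
  smul_mem' := by
    rintro c U ⟨⟨u, hp, hl, he, hg⟩, hm⟩
    refine ⟨⟨c • u, fun k => ?_, hl.smul c, ?_, fun i => ?_⟩, ?_⟩
    · filter_upwards [hp k] with y h
      simp [h]
    · exact (Lp.coeFn_smul c (U none)).trans (he.const_smul c)
    · obtain ⟨g, h1, h2, h3⟩ := hg i
      exact ⟨c • g, h1.smul c, h2.smul c, (Lp.coeFn_smul c (U (some i))).trans (h3.const_smul c)⟩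
    · change ∫ y in cellY N, (c • U none : L2 (cellY N)) y = 0
      rw [integral_congr_ae (Lp.coeFn_smul c (U none))]
      simp only [Pi.smul_apply]
      rw [integral_smul, hm, smul_zero]

/-- `H¹_#(Y; ℝ)^N`. -/
abbrev H1perN (N : ℕ) : Type := PiLp 2 (fun _ : Fin N => H1per N)

instance instNormedAddCommGroupH1perN (N : ℕ) : NormedAddCommGroup (H1perN N) :=
  PiLp.normedAddCommGroup 2 _

instance instInnerProductSpaceH1perN (N : ℕ) :
    InnerProductSpace ℝ (H1perN N) := PiLp.innerProductSpace _

instance instNormedSpaceH1perN (N : ℕ) : NormedSpace ℝ (H1perN N) :=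
  InnerProductSpace.toNormedSpace

/-- The partial derivative `∂w^k/∂y_j ∈ L²(Y)` of `w ∈ H¹_#(Y)^N`. -/
def pdY (w : H1perN N) (k j : Fin N) : L2 (cellY N) :=
  (w k : H1Amb (cellY N)) (some j)

/-- `V_Y = {w ∈ H¹_#(Y; ℝ)^N : div_y w = 0}`. -/
def VY (N : ℕ) : Submodule ℝ (H1perN N) where
  carrier := {w | ∑ k, pdY w k k = 0}
  add_mem' {u v} hu hv := by
    have h : ∀ k, pdY (u + v) k k = pdY u k k + pdY v k k := fun _ => rfl
    simp only [mem_ofPred_eq] at hu hv ⊢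
    simp [h, Finset.sum_add_distrib, hu, hv]
  zero_mem' := by
    have h : ∀ k, pdY (0 : H1perN N) k k = 0 := fun _ => rfl
    simp [h]
  smul_mem' c u hu := by
    have h : ∀ k, pdY (c • u) k k = c • pdY u k k := fun _ => rfl
    simp only [mem_ofPred_eq] at hu ⊢
    simp [h, ← Finset.smul_sum, hu]

instance instNormedAddCommGroupVY (N : ℕ) : NormedAddCommGroup (VY N) :=
  Submodule.normedAddCommGroup _

instance instInnerProductSpaceVY (N : ℕ) :
    InnerProductSpace ℝ (VY N) := Submodule.innerProductSpace _

instance instNormedSpaceVY (N : ℕ) : NormedSpace ℝ (VY N) :=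
  InnerProductSpace.toNormedSpace

/-- `L²_per(Z; V_Y)`: a `Z`-periodic function is identified with its restriction to the period
`Z`. -/
abbrev L2perZ (N : ℕ) : Type := Lp (VY N) 2 (volume.restrict cellZ)

/-- The bilinear form
`â(u, v) = ∑_{i,j,k} ∬_{Y×Z} a_{ij} ∂u^k/∂y_j ∂v^k/∂y_i dy dτ` on `L²_per(Z; V_Y)`. -/
def aHat (a : Fin N → Fin N → E N → ℝ) (u v : L2perZ N) : ℝ :=
  ∑ i, ∑ j, ∑ k, ∫ τ in cellZ, ∫ y in cellY N,
    a i j y * pdY (u τ : H1perN N) k j y * pdY (v τ : H1perN N) k i y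

/-- The cell problem for the corrector `χ_{ik}`:
`â(χ_{ik}, w) = ∑_l ∬_{Y×Z} a_{li} ∂w^k/∂y_l dy dτ` for all `w ∈ L²_per(Z; V_Y)`. -/
def SolvesCell (a : Fin N → Fin N → E N → ℝ) (i k : Fin N) (χ : L2perZ N) : Prop :=
  ∀ w : L2perZ N, aHat a χ w =
    ∑ l, ∫ τ in cellZ, ∫ y in cellY N, a l i y * pdY (w τ : H1perN N) k l y

open Classical in
/-- The family `(χ_{ik})` of solutions of the cell problems. For bounded, symmetric and uniformly
elliptic `a`, the family exists and is unique by the Lax-Milgram theorem; the value `0` is only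
there to make the definition total. -/
def corrector (a : Fin N → Fin N → E N → ℝ) : Fin N → Fin N → L2perZ N :=
  if h : ∃ χ : Fin N → Fin N → L2perZ N, ∀ i k, SolvesCell a i k (χ i k) then h.choose else 0

/-- The homogenized coefficients
`q_{ijkh} = δ_{kh} ∫_Y a_{ij} dy - ∑_l ∬_{Y×Z} a_{il} ∂χ_{jh}^k/∂y_l dy dτ`. -/
def q (a : Fin N → Fin N → E N → ℝ) (i j k h : Fin N) : ℝ :=
  (if k = h then 1 else 0) * (∫ y in cellY N, a i j y) -
    ∑ l, ∫ τ in cellZ, ∫ y in cellY N, a i l y * pdY (corrector a j h τ : H1perN N) k l y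

end Periodic

/-! ### Weak solutions of the homogenized problem -/

section Solution

variable {N : ℕ}

/-- `(u, p)` is a weak solution, with `u ∈ W(0,T)` and `p ∈ L²(0,T; L²(Ω)/ℝ)`, of the problem

`∂u/∂t + 𝒬 u + grad p = f` in `Q`, `div u = 0` in `Q`, `u = 0` on `∂Ω × ]0,T[`, `u(0) = 0` in `Ω`,

where `(𝒬 z)^k = -∑_{i,j,h} q_{ijkh} ∂²z^h/∂x_i∂x_j`. The first equation is understood in the sense
of distributions on `Q`. The second and the third ones are contained in the fact that `u` takes its
values in `V`. -/
structure IsWeakSolution (Ω : Opens (E N)) (T : ℝ) (a : Fin N → Fin N → E N → ℝ)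
    (f : L2T T (Hneg1N Ω)) (u : L2T T (V Ω)) (p : L2T T (L2mod Ω)) : Prop where
  mem_W : u ∈ W Ω T
  equation : ∀ ψ : 𝓓(cylinder Ω T, E N),
    -(∫ t in Ioo 0 T, ∑ k, ∫ x in (Ω : Set (E N)),
        comp (u t : H10N Ω) k x * fderiv ℝ ψ (x, t) (0, 1) k)
      + (∫ t in Ioo 0 T, ∑ i, ∑ j, ∑ k, ∑ h, ∫ x in (Ω : Set (E N)),
        q a i j k h * pd (u t : H10N Ω) h j x * fderiv ℝ ψ (x, t) (e i, 0) k)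
      - (∫ t in Ioo 0 T, ∫ x in (Ω : Set (E N)),
        (p t : L2 (Ω : Set (E N))) x * ∑ k, fderiv ℝ ψ (x, t) (e k, 0) k)
      = ∫ t in Ioo 0 T, f t (sliceH10N ψ t)
  initial : VanishesAtZero Ω T u

end Solution

end

end StokesHom

open StokesHom

/-! The difference `U` of two velocities and `P` of two pressures solves the problem with zero data.
Three facts force both to vanish.

The homogenized form is nonnegative. For a matrix `z`, let `χ_z` be the combination of the
correctors with weights `z_{jh}`. The cell equation says that the flux of `z - ∇_y χ_z` is
orthogonal to `∇_y χ_z`, so `∑ q_{ijkh} z_{jh} z_{ik}` equals the energy of `z - ∇_y χ_z`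
(`sum_q_eq`). This is nonnegative because the coefficients are pointwise elliptic (`sum_q_nonneg`).
The bound holds for all matrices, so it can be used pointwise in `Ω` with `z` the gradient of a
field (`formL_self_nonneg`).

The velocity vanishes (`eq_zero_of_weak_equation`). Products `φ(t) η(x) e_k` suffice as test
functions; `η` extends by density to all of `H₀¹(Ω)`, so fields of `V` may be used and eliminate the
pressure. Integrating in time from the zero initial value gives `(U(t), v) = -form(∫₀ᵗ U, v)` for
all `v ∈ V`. Taking `v = ∫₀ᵗ U` makes the derivative of the squared `L²` norm of this primitive
nonpositive. The primitive starts at zero, hence stays zero, and so does `U`. Working with the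
primitive replaces the energy identity in `W(0,T)` by the differentiation of a `C¹` function.

The pressure vanishes (`pressure_eq_zero`). With `U = 0` the equation says `grad P(t) = 0` for
almost every `t`; on a connected set `P(t)` is constant, and its mean is zero. -/

namespace StokesHom

noncomputable section

/-! ### Functions with vanishing distributional gradient -/

section Constancy

open Filter Metric
open scoped Topology Convolution

variable {G : Type*} [NormedAddCommGroup G] [InnerProductSpace ℝ G] [FiniteDimensional ℝ G]
  [MeasurableSpace G] [BorelSpace G] {μ : Measure G} [μ.IsAddHaarMeasure]

/-- A locally integrable function whose distributional gradient vanishes on a neighbourhood of a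
closed ball is almost everywhere constant on a smaller ball. -/
theorem ae_eq_const_ball_of_weak_fderiv_eq_zero {f : G → ℝ} {x : G} {R : ℝ} (hR : 0 < R)
    (hf : IntegrableOn f (closedBall x R) μ)
    (h : ∀ g : G → ℝ, ContDiff ℝ ∞ g → HasCompactSupport g → tsupport g ⊆ closedBall x R →
      ∀ v, ∫ y, f y * fderiv ℝ g y v ∂μ = 0) :
    ∃ c, ∀ᵐ y ∂μ, y ∈ ball x (R / 2) → f y = c := by
  -- Extension by zero gives a globally integrable function that can be mollified.
  set F : G → ℝ := (closedBall x R).indicator f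
  have hF : Integrable F μ := hf.integrable_indicator measurableSet_closedBall
  -- Outer radii are at most `R / 2`, so mollifiers centred in the half ball are supported in
  -- `closedBall x R`. The ratio of the radii is always `2`, as almost everywhere convergence
  -- requires a bounded ratio.
  let φ : ℕ → ContDiffBump (0 : G) := fun n =>
    ⟨R / (4 * (n + 1)), R / (2 * (n + 1)), by positivity, by gcongr; norm_num⟩
  have hφ0 : Tendsto (fun n => (φ n).rOut) atTop (𝓝 0) := by
    have := (tendsto_one_div_add_atTop_nhds_zero_nat (𝕜 := ℝ)).const_mul (R / 2)
    simp only [mul_zero] at this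
    refine this.congr fun n => ?_
    simp only [φ]; field_simp
  have hφR : ∀ n, (φ n).rOut ≤ R / 2 := fun n => by
    simp only [φ]
    gcongr
    linarith [(Nat.cast_nonneg n : (0 : ℝ) ≤ n)]
  have hlim := ContDiffBump.ae_convolution_tendsto_right_of_locallyIntegrable (μ := μ) (φ := φ)
    (K := 2) hφ0 (Eventually.of_forall fun n => by
      simp only [φ]; apply le_of_eq; field_simp; norm_num)
    hF.locallyIntegrable
  -- The gradient of the mollification at `w` is, up to sign, the integral of `f` against the
  -- gradient of the test function `y ↦ φ_n (w - y)`, which vanishes by hypothesis.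
  have hconst : ∀ n, ∀ y ∈ ball x (R / 2), ∀ z ∈ ball x (R / 2),
      ((φ n).normed μ ⋆[ContinuousLinearMap.lsmul ℝ ℝ, μ] F) y =
      ((φ n).normed μ ⋆[ContinuousLinearMap.lsmul ℝ ℝ, μ] F) z := by
    intro n
    have hsm : ContDiff ℝ ∞ ((φ n).normed μ) := (φ n).contDiff_normed
    have hder : ∀ y, HasFDerivAt ((φ n).normed μ ⋆[ContinuousLinearMap.lsmul ℝ ℝ, μ] F) _ y :=
      fun y => HasCompactSupport.hasFDerivAt_convolution_left (ContinuousLinearMap.lsmul ℝ ℝ)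
        (φ n).hasCompactSupport_normed (hsm.of_le (by simp)) hF.locallyIntegrable y
    intro y hy z hz
    refine isOpen_ball.is_const_of_fderiv_eq_zero (𝕜 := ℝ) (convex_ball x _).isPreconnected
      (fun w _ => (hder w).differentiableAt.differentiableWithinAt) (fun w hw => ?_) hy hz
    rw [(hder w).fderiv]
    ext v
    have hg : ContDiff ℝ ∞ fun y => (φ n).normed μ (w - y) :=
      hsm.comp (contDiff_const.sub contDiff_id)
    have hts : tsupport (fun y => (φ n).normed μ (w - y)) ⊆ closedBall w (R / 2) := by
      refine closure_minimal (fun y hy => ?_) isClosed_closedBall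
      have h1 : w - y ∈ ball (0 : G) (φ n).rOut := by
        rw [← (φ n).support_normed_eq (μ := μ)]
        exact hy
      rw [mem_ball_zero_iff] at h1
      rw [mem_closedBall, dist_comm, dist_eq_norm]
      exact h1.le.trans (hφR n)
    have hfd : ∀ y, fderiv ℝ (fun y => (φ n).normed μ (w - y)) y v =
        -fderiv ℝ ((φ n).normed μ) (w - y) v := fun y => by
      have h1 : HasFDerivAt (fun y => w - y) (-ContinuousLinearMap.id ℝ G) y :=
        (hasFDerivAt_id y).const_sub w
      have h2 := ((hsm.differentiable (by simp) (w - y)).hasFDerivAt).comp y h1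
      have h3 : HasFDerivAt (fun y => (φ n).normed μ (w - y)) _ y := h2
      rw [h3.fderiv]
      simp
    have hsub : tsupport (fun y => (φ n).normed μ (w - y)) ⊆ closedBall x R := by
      refine hts.trans (closedBall_subset_closedBall' ?_)
      linarith [mem_ball.1 hw]
    have hz := h _ hg (HasCompactSupport.of_support_subset_isCompact
      (isCompact_closedBall w (R / 2)) ((subset_tsupport _).trans hts)) hsub v
    have hex : ConvolutionExistsAt (fderiv ℝ ((φ n).normed μ)) F w
        ((ContinuousLinearMap.lsmul ℝ ℝ).precompL G) μ :=
      ((φ n).hasCompactSupport_normed.fderiv ℝ).convolutionExists_left _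
        (hsm.continuous_fderiv (by simp)) hF.locallyIntegrable w
    rw [convolution_def, ContinuousLinearMap.integral_apply hex]
    simp only [ContinuousLinearMap.precompL_apply, ContinuousLinearMap.lsmul_apply, smul_eq_mul,
      _root_.zero_apply, Pi.zero_apply]
    rw [← integral_sub_left_eq_self _ μ w]
    simp only [sub_sub_cancel]
    rw [← neg_eq_zero, ← integral_neg, ← hz]
    refine integral_congr_ae (Eventually.of_forall fun y => ?_)
    simp only [hfd]
    by_cases hy : y ∈ closedBall x R
    · simp only [F, indicator_of_mem hy]; ring
    · have h0 : (fderiv ℝ (fun y => (φ n).normed μ (w - y)) y) v = 0 := by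
        have := notMem_subset ((support_fderiv_subset ℝ).trans hsub) hy
        rw [Function.notMem_support.1 this]; rfl
      rw [hfd, neg_eq_zero] at h0
      simp [h0]
  -- The half ball has positive measure, so it contains a point of convergence; its limit is the
  -- constant.
  obtain ⟨y₀, hy₀, hl₀⟩ : ∃ y₀ ∈ ball x (R / 2),
      Tendsto (fun n => ((φ n).normed μ ⋆[ContinuousLinearMap.lsmul ℝ ℝ, μ] F) y₀) atTop
        (𝓝 (F y₀)) := by
    have hpos : μ (ball x (R / 2)) ≠ 0 := (measure_ball_pos μ x (by positivity)).ne'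
    have hfr : ∃ᶠ y in ae μ, y ∈ ball x (R / 2) := frequently_ae_mem_iff.2 hpos
    obtain ⟨y, h1, h2⟩ := (hfr.and_eventually hlim).exists
    exact ⟨y, h1, h2⟩
  refine ⟨F y₀, ?_⟩
  filter_upwards [hlim] with y hy hyb
  have h1 : F y = f y :=
    indicator_of_mem (ball_subset_closedBall (ball_subset_ball (by linarith) hyb)) f
  rw [← h1]
  exact tendsto_nhds_unique (hy.congr fun n => hconst n y hyb y₀ hy₀) hl₀

/-- A locally integrable function with zero distributional gradient on a connected open set is
almost everywhere constant there. -/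
theorem ae_eq_const_of_weak_fderiv_eq_zero {f : G → ℝ} {U : Set G} (hU : IsOpen U)
    (hUc : IsPreconnected U) (hf : IntegrableOn f U μ)
    (h : ∀ g : G → ℝ, ContDiff ℝ ∞ g → HasCompactSupport g → tsupport g ⊆ U →
      ∀ v, ∫ y, f y * fderiv ℝ g y v ∂μ = 0) :
    ∃ c, ∀ᵐ y ∂μ, y ∈ U → f y = c := by
  have hloc : ∀ x ∈ U, ∃ r > 0, ∃ c, ∀ᵐ y ∂μ, y ∈ ball x r → f y = c := by
    intro x hx
    obtain ⟨R, hR, hRU⟩ := nhds_basis_closedBall.mem_iff.1 (hU.mem_nhds hx)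
    exact ⟨R / 2, by positivity, ae_eq_const_ball_of_weak_fderiv_eq_zero hR (hf.mono_set hRU)
      fun g hg hgc hgs v => h g hg hgc (hgs.trans hRU) v⟩
  obtain rfl | ⟨x₀, hx₀⟩ := U.eq_empty_or_nonempty
  · exact ⟨0, by simp⟩
  obtain ⟨r₀, hr₀, c, hc⟩ := hloc x₀ hx₀
  refine ⟨c, ?_⟩
  -- `S` and `S'` collect the points near which the local constant is `c`, respectively differs from
  -- `c`. Both are open and they cover `U`; they are disjoint because two concentric balls meet in a
  -- set of positive measure. Connectedness leaves only `S`.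
  let S : Set G := {x | ∃ r > 0, ∀ᵐ y ∂μ, y ∈ ball x r → f y = c}
  let S' : Set G := {x | ∃ r > 0, ∃ c' ≠ c, ∀ᵐ y ∂μ, y ∈ ball x r → f y = c'}
  have key : ∀ (P : G → Prop), IsOpen {x | ∃ r > 0, ∀ᵐ y ∂μ, y ∈ ball x r → P y} := by
    intro P
    rw [Metric.isOpen_iff]
    rintro x ⟨r, hr, hy⟩
    refine ⟨r / 2, by positivity, fun z hz => ⟨r / 2, by positivity, ?_⟩⟩
    filter_upwards [hy] with y hy hyz
    refine hy (ball_subset_ball' ?_ hyz)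
    linarith [mem_ball.1 hz]
  have hS : IsOpen S := key _
  have hS' : IsOpen S' := by
    have : S' = ⋃ c' ∈ {c' | c' ≠ c}, {x | ∃ r > 0, ∀ᵐ y ∂μ, y ∈ ball x r → f y = c'} := by
      ext x
      simp only [S', mem_ofPred_eq, mem_iUnion]
      constructor
      · rintro ⟨r, hr, c', hc', h⟩
        exact ⟨c', hc', r, hr, h⟩
      · rintro ⟨c', hc', r, hr, h⟩
        exact ⟨r, hr, c', hc', h⟩
    rw [this]
    exact isOpen_biUnion fun c' _ => key _
  have hdisj : ∀ x, x ∈ S → x ∈ S' → False := by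
    rintro x ⟨r, hr, h1⟩ ⟨r', hr', c', hc', h2⟩
    have hpos : μ (ball x (min r r')) ≠ 0 := (measure_ball_pos μ x (lt_min hr hr')).ne'
    obtain ⟨y, hy, h1, h2⟩ := ((frequently_ae_mem_iff.2 hpos).and_eventually (h1.and h2)).exists
    exact hc' ((h2 (ball_subset_ball (min_le_right _ _) hy)).symm.trans
      (h1 (ball_subset_ball (min_le_left _ _) hy)))
  have hsub : U ⊆ S := by
    refine hUc.subset_left_of_subset_union hS hS' (disjoint_left.2 hdisj) (fun x hx => ?_)
      ⟨x₀, hx₀, r₀, hr₀, hc⟩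
    obtain ⟨r, hr, c', h⟩ := hloc x hx
    by_cases hcc : c' = c
    · exact Or.inl ⟨r, hr, hcc ▸ h⟩
    · exact Or.inr ⟨r, hr, c', hcc, h⟩
  have hnull : μ (U ∩ {y | f y ≠ c}) = 0 := by
    refine measure_null_of_locally_null _ fun x hx => ?_
    obtain ⟨r, hr, h⟩ := hsub hx.1
    refine ⟨U ∩ {y | f y ≠ c} ∩ ball x r, inter_mem_nhdsWithin _ (ball_mem_nhds x hr), ?_⟩
    refine measure_mono_null ?_ (ae_iff.1 h)
    rintro y ⟨⟨_, h1⟩, h2⟩ h3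
    exact h1 (h3 h2)
  rw [ae_iff]
  refine measure_mono_null (fun y hy => ?_) hnull
  simp only [mem_ofPred_eq, Classical.not_imp] at hy
  exact hy

/-- If `f` is continuous on `[0,T]` with `f 0 = 0` and `g` is its distributional derivative on
`]0,T[`, then `f` is the primitive of `g`. -/
theorem eq_intervalIntegral_of_weak_deriv {T : ℝ} (hT : 0 < T) {f g : ℝ → ℝ}
    (hf : ContinuousOn f (Icc 0 T)) (hf0 : f 0 = 0) (hg : IntegrableOn g (Ioo 0 T))
    (h : ∀ φ : 𝓓(timeInterval T, ℝ),
      ∫ t in Ioo 0 T, deriv φ t * f t = -∫ t in Ioo 0 T, φ t * g t) :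
    ∀ t ∈ Icc 0 T, f t = ∫ s in (0 : ℝ)..t, g s := by
  have hgi : IntervalIntegrable g volume 0 T := by
    rw [intervalIntegrable_iff_integrableOn_Ioo_of_le hT.le]
    exact hg
  set P : ℝ → ℝ := fun t => ∫ s in (0 : ℝ)..t, g s
  have hP : AbsolutelyContinuousOnInterval P 0 T :=
    hgi.absolutelyContinuousOnInterval_intervalIntegral (by simp)
  have hPc : ContinuousOn P (Icc 0 T) := by simpa [uIcc_of_le hT.le] using hP.continuousOn
  have hd : ContinuousOn (fun t => f t - P t) (Icc 0 T) := hf.sub hPc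
  have hcon : ∃ c, ∀ᵐ t, t ∈ Ioo 0 T → f t - P t = c := by
    refine ae_eq_const_of_weak_fderiv_eq_zero isOpen_Ioo isPreconnected_Ioo
      (hd.integrableOn_Icc.mono_set Ioo_subset_Icc_self) fun η hη hηc hηs v => ?_
    let φ : 𝓓(timeInterval T, ℝ) := ⟨η, hη, hηc, hηs⟩
    have hφ0 : ∀ t, t ∉ Ioo 0 T → η t = 0 := fun t ht =>
      Function.notMem_support.1 fun h1 => ht (hηs (subset_tsupport _ h1))
    have hφd0 : ∀ t, t ∉ Ioo 0 T → deriv η t = 0 := fun t ht =>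
      Function.notMem_support.1 fun h1 => ht (hηs (support_deriv_subset h1))
    have hdc : Continuous (deriv η) := hη.continuous_deriv (by simp)
    -- The primitive `P` is absolutely continuous, so it can be integrated by parts against `η`,
    -- which vanishes at both endpoints. Hence `f - P` has zero weak derivative.
    have hparts := AbsolutelyContinuousOnInterval.integral_mul_deriv_eq_deriv_mul (f := η) (g := P)
      (a := 0) (b := T) (hη.of_le (by simp)).contDiffOn.absolutelyContinuousOnInterval hP
    rw [hφ0 0 (by simp), hφ0 T (by simp), intervalIntegral.integral_of_le hT.le,
      intervalIntegral.integral_of_le hT.le, integral_Ioc_eq_integral_Ioo,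
      integral_Ioc_eq_integral_Ioo] at hparts
    have hdP : ∫ t in Ioo 0 T, η t * deriv P t = ∫ t in Ioo 0 T, η t * g t := by
      refine integral_congr_ae ?_
      filter_upwards [ae_restrict_mem measurableSet_Ioo,
        ae_restrict_of_ae hgi.ae_hasDerivAt_integral] with t ht h1
      rw [(h1 (by rw [uIcc_of_le hT.le]; exact Ioo_subset_Icc_self ht) 0 (by simp)).deriv]
    have h0 := h φ
    change ∫ t in Ioo 0 T, deriv η t * f t = -∫ t in Ioo 0 T, η t * g t at h0
    have hint : ∀ F : ℝ → ℝ, ContinuousOn F (Icc 0 T) →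
        IntegrableOn (fun t => deriv η t * F t) (Ioo 0 T) := fun F hF =>
      (hdc.continuousOn.mul hF).integrableOn_Icc.mono_set Ioo_subset_Icc_self
    have h2 : ∫ t in Ioo 0 T, (deriv η t * f t - deriv η t * P t) = 0 := by
      rw [integral_sub (hint f hf) (hint P hPc), h0]
      linarith
    have h3 : ∫ t, (f t - P t) * fderiv ℝ η t v =
        v * ∫ t in Ioo 0 T, (deriv η t * f t - deriv η t * P t) := by
      rw [← integral_const_mul, ← integral_indicator measurableSet_Ioo]
      refine integral_congr_ae (Eventually.of_forall fun t => ?_)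
      change (f t - P t) * fderiv ℝ η t v = _
      have h4 : fderiv ℝ η t v = v * deriv η t := by
        rw [← fderiv_apply_one_eq_deriv, ← smul_eq_mul, ← map_smul]; simp
      rw [h4]
      by_cases ht : t ∈ Ioo 0 T
      · rw [indicator_of_mem ht]; ring
      · rw [indicator_of_notMem ht, hφd0 t ht]; ring
    rw [h3, h2, mul_zero]
  obtain ⟨c, hc⟩ := hcon
  -- Continuity upgrades equality almost everywhere to equality up to the endpoints, where `f 0 = 0`
  -- fixes `c`.
  have hEq : ∀ t ∈ Icc 0 T, f t - P t = c := by
    refine Measure.eqOn_Icc_of_ae_eq volume hT.ne ?_ hd continuousOn_const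
    rw [Filter.EventuallyEq, ← restrict_Ioo_eq_restrict_Icc, ae_restrict_iff' measurableSet_Ioo]
    exact hc
  have hc0 : c = 0 := by
    rw [← hEq 0 (left_mem_Icc.2 hT.le)]
    simp [hf0, P]
  intro t ht
  linarith [hEq t ht]

end Constancy

/-! ### Weighted time integrals -/

section TimeIntegral

variable {T : ℝ} {X : Type} [NormedAddCommGroup X]

theorem L2T.integrable (u : L2T T X) : Integrable u (volume.restrict (Ioo 0 T)) :=
  (Lp.memLp u).integrable one_le_two

variable [NormedSpace ℝ X]

/-- The integral over `]0,T[` of `u` against the scalar weight `θ`. -/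
def timeInt (θ : ℝ → ℝ) (u : L2T T X) : X := ∫ t in Ioo 0 T, θ t • u t


theorem L2T.integrable_smul (u : L2T T X) {θ : ℝ → ℝ} (hθ : Continuous θ)
    (hc : HasCompactSupport θ) :
    Integrable (fun t => θ t • u t) (volume.restrict (Ioo 0 T)) := by
  obtain ⟨C, hC⟩ := hθ.bounded_above_of_compact_support hc
  exact (L2T.integrable u).bdd_smul C hθ.aestronglyMeasurable (Filter.Eventually.of_forall hC)

/-- Bounded operators commute with the Bochner integral. Spatial functionals may thus be applied to
one fixed element, the weighted time integral, instead of being integrated in time. -/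
theorem clm_timeInt [CompleteSpace X] {Y : Type*} [NormedAddCommGroup Y] [NormedSpace ℝ Y]
    [CompleteSpace Y] (L : X →L[ℝ] Y) (u : L2T T X) {θ : ℝ → ℝ}
    (hθ : Continuous θ) (hc : HasCompactSupport θ) :
    ∫ t in Ioo 0 T, θ t • L (u t) = L (timeInt θ u) := by
  rw [timeInt, ← L.integral_comp_comm (L2T.integrable_smul u hθ hc)]
  simp

theorem timeInt_sub (u u' : L2T T X) {θ : ℝ → ℝ} (hθ : Continuous θ) (hc : HasCompactSupport θ) :
    timeInt θ (u - u') = timeInt θ u - timeInt θ u' := by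
  rw [timeInt, timeInt, timeInt,
    ← integral_sub (L2T.integrable_smul u hθ hc) (L2T.integrable_smul u' hθ hc)]
  refine integral_congr_ae ?_
  filter_upwards [Lp.coeFn_sub u u'] with t ht
  rw [ht, Pi.sub_apply, smul_sub]

end TimeIntegral

/-! ### Completeness and inner products in the spatial spaces -/

section Dirichlet

variable {N : ℕ} {Ω : Opens (E N)}

theorem isClosed_H10 : IsClosed (H10 Ω : Set (H1Amb (Ω : Set (E N)))) :=
  Submodule.isClosed_topologicalClosure _

instance : CompleteSpace (H10 Ω) := isClosed_H10.completeSpace_coe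

instance : CompleteSpace (H10N Ω) := inferInstanceAs (CompleteSpace (PiLp 2 fun _ : Fin N => H10 Ω))

/-- `u ↦ u^k` as a continuous linear map. -/
def compL (Ω : Opens (E N)) (k : Fin N) : H10N Ω →L[ℝ] L2 (Ω : Set (E N)) :=
  (PiLp.proj 2 (fun _ : Option (Fin N) => L2 (Ω : Set (E N))) none) ∘L (H10 Ω).subtypeL ∘L
    (PiLp.proj 2 (fun _ : Fin N => H10 Ω) k)

/-- `u ↦ ∂u^k/∂x_j` as a continuous linear map. -/
def pdL (Ω : Opens (E N)) (k j : Fin N) : H10N Ω →L[ℝ] L2 (Ω : Set (E N)) :=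
  (PiLp.proj 2 (fun _ : Option (Fin N) => L2 (Ω : Set (E N))) (some j)) ∘L (H10 Ω).subtypeL ∘L
    (PiLp.proj 2 (fun _ : Fin N => H10 Ω) k)

theorem compL_apply (k : Fin N) (u : H10N Ω) : compL Ω k u = comp u k := rfl

theorem pdL_apply (k j : Fin N) (u : H10N Ω) : pdL Ω k j u = pd u k j := rfl

theorem V_eq_ker :
    (V Ω) = LinearMap.ker (∑ k, pdL Ω k k : H10N Ω →L[ℝ] L2 (Ω : Set (E N))).toLinearMap := by
  ext u
  rw [LinearMap.mem_ker]
  change ∑ k, pd u k k = 0 ↔ (∑ k, pdL Ω k k) u = 0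
  rw [_root_.sum_apply]
  rfl

instance : CompleteSpace (V Ω) := by
  have h : IsClosed (V Ω : Set (H10N Ω)) := by
    rw [V_eq_ker]
    exact ContinuousLinearMap.isClosed_ker _
  exact h.completeSpace_coe

theorem inner_toLp {A : Set (E N)} (f : L2 A) {g : E N → ℝ} (hg : MemLp g 2 (volume.restrict A)) :
    inner ℝ f hg.toLp = ∫ x in A, f x * g x := by
  rw [L2.inner_def]
  refine integral_congr_ae ?_
  filter_upwards [hg.coeFn_toLp] with x hx
  rw [hx]
  simp [mul_comm]

theorem inner_L2 {A : Set (E N)} (f g : L2 A) :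
    inner ℝ f g = ∫ x in A, f x * g x := by
  rw [L2.inner_def]
  refine integral_congr_ae (Filter.Eventually.of_forall fun x => ?_)
  simp [mul_comm]

/-- The component `h o` of `h ∈ L²(A) × L²(A)^N`. -/
def coord {A : Set (E N)} (h : H1Amb A) (o : Option (Fin N)) : L2 A := h o

theorem coord_testGraph (η : 𝓓(Ω, ℝ)) (o : Option (Fin N)) :
    coord (testGraph Ω η) o = (testComp_memLp η o).toLp := rfl

theorem inner_testGraph (f : L2 (Ω : Set (E N))) (η : 𝓓(Ω, ℝ)) (o : Option (Fin N)) :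
    inner ℝ f (coord (testGraph Ω η) o) = ∫ x in (Ω : Set (E N)), f x * testComp η o x :=
  inner_toLp f (testComp_memLp η o)

/-- On a bounded `Ω` the constant `1` lies in `L²(Ω)`, and the space is its orthogonal complement.
Closedness gives the completeness needed for Bochner integrals with values in it. -/
theorem isClosed_L2mod (hΩ : Bornology.IsBounded (Ω : Set (E N))) :
    IsClosed (L2mod Ω : Set (L2 (Ω : Set (E N)))) := by
  have : IsFiniteMeasure (volume.restrict (Ω : Set (E N))) := ⟨by simpa using hΩ.measure_lt_top⟩
  have h : (L2mod Ω : Set (L2 (Ω : Set (E N)))) =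
      {v | inner ℝ v ((memLp_const (1 : ℝ)).toLp : L2 (Ω : Set (E N))) = 0} := by
    ext v
    rw [mem_ofPred_eq, inner_toLp]
    simp only [mul_one]
    exact ⟨fun h => h.2, fun h => ⟨(Lp.memLp v).integrable one_le_two, h⟩⟩
  rw [h]
  exact isClosed_eq (by fun_prop) continuous_const

end Dirichlet

/-! ### Test functions with separated variables -/

section Tensor

variable {N : ℕ} {Ω : Opens (E N)} {T : ℝ}

/-- The test function `(x, t) ↦ φ(t) η(x) e_k` on the cylinder. -/
def tensorTest (φ : 𝓓(timeInterval T, ℝ)) (η : 𝓓(Ω, ℝ)) (k : Fin N) : 𝓓(cylinder Ω T, E N) where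
  toFun z := (φ z.2 * η z.1) • e k
  contDiff' := ((φ.contDiff.comp contDiff_snd).mul (η.contDiff.comp contDiff_fst)).smul
    contDiff_const
  hasCompactSupport' := by
    refine HasCompactSupport.intro (η.hasCompactSupport.isCompact.prod φ.hasCompactSupport.isCompact)
      fun z hz => ?_
    rw [mem_prod, not_and_or] at hz
    rcases hz with hz | hz <;> simp [image_eq_zero_of_notMem_tsupport hz]
  tsupport_subset' := by
    have h : tsupport (fun z : E N × ℝ => (φ z.2 * η z.1) • (e k : E N)) ⊆
        tsupport η ×ˢ tsupport φ := by
      refine closure_minimal (fun z hz => ?_) ((isClosed_tsupport _).prod (isClosed_tsupport _))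
      by_contra hz'
      rw [mem_prod, not_and_or] at hz'
      apply hz
      rcases hz' with hz' | hz' <;> simp [image_eq_zero_of_notMem_tsupport hz']
    exact h.trans (prod_mono η.tsupport_subset φ.tsupport_subset)

theorem fderiv_tensorTest (φ : 𝓓(timeInterval T, ℝ)) (η : 𝓓(Ω, ℝ)) (k : Fin N) (x : E N) (t : ℝ)
    (dx : E N) (dt : ℝ) :
    fderiv ℝ (tensorTest φ η k) (x, t) (dx, dt) =
      (dt * deriv φ t * η x + φ t * fderiv ℝ η x dx) • (e k : E N) := by
  have h1 : HasFDerivAt (fun z : E N × ℝ => φ z.2)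
      ((fderiv ℝ φ t) ∘L ContinuousLinearMap.snd ℝ (E N) ℝ) (x, t) :=
    ((φ.contDiff.differentiable (by simp) t).hasFDerivAt).comp (x, t) hasFDerivAt_snd
  have h2 : HasFDerivAt (fun z : E N × ℝ => η z.1)
      ((fderiv ℝ η x) ∘L ContinuousLinearMap.fst ℝ (E N) ℝ) (x, t) :=
    ((η.contDiff.differentiable (by simp) x).hasFDerivAt).comp (x, t) hasFDerivAt_fst
  have h3 : HasFDerivAt (tensorTest φ η k) _ (x, t) := (h1.mul h2).smul_const (e k : E N)
  rw [h3.fderiv]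
  have h4 : fderiv ℝ φ t dt = dt * deriv φ t := by
    rw [← fderiv_apply_one_eq_deriv, ← smul_eq_mul, ← map_smul]; simp
  rw [ContinuousLinearMap.smulRight_apply]
  congr 1
  simp [h4]
  ring

theorem fderiv_tensorTest_time (φ : 𝓓(timeInterval T, ℝ)) (η : 𝓓(Ω, ℝ)) (k l : Fin N) (x : E N)
    (t : ℝ) :
    fderiv ℝ (tensorTest φ η k) (x, t) (0, 1) l =
      if l = k then deriv φ t * testComp η none x else 0 := by
  rw [fderiv_tensorTest]
  simp [testComp]

theorem fderiv_tensorTest_space (φ : 𝓓(timeInterval T, ℝ)) (η : 𝓓(Ω, ℝ)) (k l i : Fin N) (x : E N)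
    (t : ℝ) :
    fderiv ℝ (tensorTest φ η k) (x, t) (e i, 0) l =
      if l = k then φ t * testComp η (some i) x else 0 := by
  rw [fderiv_tensorTest]
  simp [testComp]

end Tensor

/-! ### The weak equation with time integrated out -/

section Equation

variable {N : ℕ} {Ω : Opens (E N)} {T : ℝ}

/-- The left-hand side of the weak equation, with the time integration already carried out, against
a pair `h = (η, ∇η)` in the `k`-th component. -/
def weakLHS (Ω : Opens (E N)) (a : Fin N → Fin N → E N → ℝ) (k : Fin N) (v w : H10N Ω)
    (π : L2 (Ω : Set (E N))) (h : H1Amb (Ω : Set (E N))) : ℝ :=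
  -inner ℝ (comp v k) (coord h none) +
    ∑ i, ∑ j, ∑ l, q a i j k l * inner ℝ (pd w l j) (coord h (some i)) - inner ℝ π (coord h (some k))

/-- The spatial term of the weak equation as a continuous linear functional. -/
def qL (Ω : Opens (E N)) (a : Fin N → Fin N → E N → ℝ) (k : Fin N) (h : H1Amb (Ω : Set (E N))) :
    H10N Ω →L[ℝ] ℝ :=
  ∑ i, ∑ j, ∑ l, q a i j k l • (innerSL ℝ (coord h (some i))) ∘L pdL Ω l j

theorem qL_apply (a : Fin N → Fin N → E N → ℝ) (k : Fin N) (h : H1Amb (Ω : Set (E N)))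
    (w : H10N Ω) :
    qL Ω a k h w = ∑ i, ∑ j, ∑ l, q a i j k l * inner ℝ (pd w l j) (coord h (some i)) := by
  simp only [qL, _root_.sum_apply, _root_.smul_apply, ContinuousLinearMap.comp_apply,
    innerSL_apply_apply, pdL_apply, smul_eq_mul, real_inner_comm]

theorem clm_timeInt_V (L : H10N Ω →L[ℝ] ℝ) (u : L2T T (V Ω)) {θ : ℝ → ℝ}
    (hθ : Continuous θ) (hc : HasCompactSupport θ) :
    L (timeInt θ u : V Ω) = ∫ t in Ioo 0 T, θ t * L (u t : H10N Ω) :=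
  (clm_timeInt (L ∘L (V Ω).subtypeL) u hθ hc).symm

theorem inner_timeInt_L2mod (hΩ : Bornology.IsBounded (Ω : Set (E N)))
    (g : L2 (Ω : Set (E N))) (p : L2T T (L2mod Ω)) {θ : ℝ → ℝ}
    (hθ : Continuous θ) (hc : HasCompactSupport θ) :
    inner ℝ ((timeInt θ p : L2mod Ω) : L2 (Ω : Set (E N))) g =
      ∫ t in Ioo 0 T, θ t * inner ℝ (p t : L2 (Ω : Set (E N))) g := by
  have : CompleteSpace (L2mod Ω) := (isClosed_L2mod hΩ).completeSpace_coe
  have h1 := (clm_timeInt ((innerSL ℝ g) ∘L (L2mod Ω).subtypeL) p hθ hc).symm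
  simp only [ContinuousLinearMap.comp_apply, innerSL_apply_apply, Submodule.subtypeL_apply,
    smul_eq_mul] at h1
  simpa only [real_inner_comm g] using h1

theorem inner_comp_timeInt (g : L2 (Ω : Set (E N))) (k : Fin N) (u : L2T T (V Ω)) {θ : ℝ → ℝ}
    (hθ : Continuous θ) (hc : HasCompactSupport θ) :
    inner ℝ (comp (timeInt θ u : V Ω) k) g =
      ∫ t in Ioo 0 T, θ t * inner ℝ (comp (u t : H10N Ω) k) g := by
  have h1 := clm_timeInt_V ((innerSL ℝ g) ∘L compL Ω k) u hθ hc
  simp only [ContinuousLinearMap.comp_apply, innerSL_apply_apply, compL_apply] at h1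
  simpa only [real_inner_comm g] using h1

theorem sum_integral_mul_ite {A : Set (E N)} (F : Fin N → E N → ℝ) (G : E N → ℝ) (c : ℝ)
    (k : Fin N) :
    ∑ l, ∫ x in A, F l x * (if l = k then c * G x else 0) = c * ∫ x in A, F k x * G x := by
  rw [Finset.sum_eq_single k (fun l _ hl => by simp [hl]) (by simp), ← integral_const_mul]
  refine integral_congr_ae (Filter.Eventually.of_forall fun x => ?_)
  simp only [if_true]
  ring

theorem timeTerm_eq (φ : 𝓓(timeInterval T, ℝ)) (η : 𝓓(Ω, ℝ)) (k : Fin N) (u : L2T T (V Ω)) :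
    ∫ t in Ioo 0 T, ∑ l, ∫ x in (Ω : Set (E N)),
        comp (u t : H10N Ω) l x * fderiv ℝ (tensorTest φ η k) (x, t) (0, 1) l =
      inner ℝ (comp (timeInt (deriv φ) u : V Ω) k) (coord (testGraph Ω η) none) := by
  rw [inner_comp_timeInt _ k u (φ.contDiff.continuous_deriv (by simp)) φ.hasCompactSupport.deriv]
  refine integral_congr_ae (Filter.Eventually.of_forall fun t => ?_)
  simp only [fderiv_tensorTest_time]
  rw [sum_integral_mul_ite, inner_testGraph]

theorem space_integrand_eq (a : Fin N → Fin N → E N → ℝ) (φ : 𝓓(timeInterval T, ℝ)) (η : 𝓓(Ω, ℝ))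
    (k : Fin N) (v : H10N Ω) (t : ℝ) :
    ∑ i, ∑ j, ∑ l, ∑ m, ∫ x in (Ω : Set (E N)),
        q a i j l m * pd v m j x * fderiv ℝ (tensorTest φ η k) (x, t) (e i, 0) l =
      φ t * qL Ω a k (testGraph Ω η) v := by
  rw [qL_apply, Finset.mul_sum]
  refine Finset.sum_congr rfl fun i _ => ?_
  rw [Finset.mul_sum]
  refine Finset.sum_congr rfl fun j _ => ?_
  rw [Finset.mul_sum, Finset.sum_comm]
  refine Finset.sum_congr rfl fun m _ => ?_
  simp only [fderiv_tensorTest_space]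
  rw [sum_integral_mul_ite (fun l x => q a i j l m * pd v m j x), inner_testGraph,
    ← integral_const_mul (q a i j k m)]
  simp only [mul_assoc]

theorem spaceTerm_eq (a : Fin N → Fin N → E N → ℝ) (φ : 𝓓(timeInterval T, ℝ)) (η : 𝓓(Ω, ℝ))
    (k : Fin N) (u : L2T T (V Ω)) :
    ∫ t in Ioo 0 T, ∑ i, ∑ j, ∑ l, ∑ m, ∫ x in (Ω : Set (E N)),
        q a i j l m * pd (u t : H10N Ω) m j x * fderiv ℝ (tensorTest φ η k) (x, t) (e i, 0) l =
      qL Ω a k (testGraph Ω η) (timeInt φ u : V Ω) := by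
  rw [clm_timeInt_V _ u φ.continuous φ.hasCompactSupport]
  exact integral_congr_ae (Filter.Eventually.of_forall fun t =>
    space_integrand_eq a φ η k (u t : H10N Ω) t)

theorem pressureTerm_eq (hΩ : Bornology.IsBounded (Ω : Set (E N))) (φ : 𝓓(timeInterval T, ℝ))
    (η : 𝓓(Ω, ℝ)) (k : Fin N) (p : L2T T (L2mod Ω)) :
    ∫ t in Ioo 0 T, ∫ x in (Ω : Set (E N)),
        (p t : L2 (Ω : Set (E N))) x * ∑ l, fderiv ℝ (tensorTest φ η k) (x, t) (e l, 0) l =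
      inner ℝ ((timeInt φ p : L2mod Ω) : L2 (Ω : Set (E N))) (coord (testGraph Ω η) (some k)) := by
  rw [inner_timeInt_L2mod hΩ _ p φ.continuous φ.hasCompactSupport]
  refine integral_congr_ae (Filter.Eventually.of_forall fun t => ?_)
  simp only [fderiv_tensorTest_space]
  rw [inner_testGraph (p t : L2 (Ω : Set (E N))) η (some k), ← integral_const_mul]
  refine integral_congr_ae (Filter.Eventually.of_forall fun x => ?_)
  simp only
  rw [Finset.sum_eq_single k (fun l _ hl => by simp [hl]) (by simp)]
  simp only [if_true]
  ring

/-- Separated test functions turn the evolution equation into a stationary identity for time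
averages. The right-hand side does not involve the solution, so it cancels between two solutions. -/
theorem IsWeakSolution.weakLHS_eq {a : Fin N → Fin N → E N → ℝ}
    {f : L2T T (Hneg1N Ω)} {u : L2T T (V Ω)} {p : L2T T (L2mod Ω)}
    (h : IsWeakSolution Ω T a f u p) (hΩ : Bornology.IsBounded (Ω : Set (E N)))
    (φ : 𝓓(timeInterval T, ℝ)) (η : 𝓓(Ω, ℝ)) (k : Fin N) :
    weakLHS Ω a k (timeInt (deriv φ) u : V Ω) (timeInt φ u : V Ω) (timeInt φ p : L2mod Ω)
      (testGraph Ω η) = ∫ t in Ioo 0 T, f t (sliceH10N (tensorTest φ η k) t) := by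
  rw [← h.equation (tensorTest φ η k), timeTerm_eq, spaceTerm_eq, pressureTerm_eq hΩ, weakLHS,
    qL_apply]

theorem weakLHS_sub (a : Fin N → Fin N → E N → ℝ) (k : Fin N) (v v' w w' : H10N Ω)
    (π π' : L2 (Ω : Set (E N))) (h : H1Amb (Ω : Set (E N))) :
    weakLHS Ω a k (v - v') (w - w') (π - π') h =
      weakLHS Ω a k v w π h - weakLHS Ω a k v' w' π' h := by
  simp only [weakLHS, ← qL_apply, ← compL_apply, map_sub, inner_sub_left]
  ring

/-- The functional `weakLHS` is continuous and linear in its last argument. -/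
theorem exists_clm_eq_weakLHS (a : Fin N → Fin N → E N → ℝ) (k : Fin N) (v w : H10N Ω)
    (π : L2 (Ω : Set (E N))) : ∃ L : H1Amb (Ω : Set (E N)) →L[ℝ] ℝ, ∀ h,
      weakLHS Ω a k v w π h = L h := by
  let P : Option (Fin N) → H1Amb (Ω : Set (E N)) →L[ℝ] L2 (Ω : Set (E N)) :=
    fun o => PiLp.proj 2 (fun _ => L2 (Ω : Set (E N))) o
  refine ⟨-(innerSL ℝ (comp v k)) ∘L P none +
    ∑ i, ∑ j, ∑ l, q a i j k l • (innerSL ℝ (pd w l j)) ∘L P (some i) -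
      (innerSL ℝ π) ∘L P (some k), fun h => ?_⟩
  simp only [weakLHS, _root_.sum_apply, _root_.smul_apply, ContinuousLinearMap.comp_apply,
    _root_.sub_apply, _root_.add_apply, _root_.neg_apply, innerSL_apply_apply, smul_eq_mul]
  rfl

/-- The difference of two weak solutions satisfies the homogeneous equation, tested with
`φ(t) h(x) e_k` for any `h ∈ H₀¹(Ω)`. -/
theorem IsWeakSolution.weakLHS_sub_eq_zero {a : Fin N → Fin N → E N → ℝ}
    {f : L2T T (Hneg1N Ω)} {u u' : L2T T (V Ω)} {p p' : L2T T (L2mod Ω)}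
    (h : IsWeakSolution Ω T a f u p) (h' : IsWeakSolution Ω T a f u' p')
    (hΩ : Bornology.IsBounded (Ω : Set (E N)))
    (φ : 𝓓(timeInterval T, ℝ)) (k : Fin N) (g : H10 Ω) :
    weakLHS Ω a k (timeInt (deriv φ) (u - u') : V Ω) (timeInt φ (u - u') : V Ω)
      (timeInt φ (p - p') : L2mod Ω) g = 0 := by
  have hdφ : Continuous (deriv φ) := φ.contDiff.continuous_deriv (by simp)
  have hdφc : HasCompactSupport (deriv φ) := φ.hasCompactSupport.deriv
  rw [timeInt_sub _ _ hdφ hdφc, timeInt_sub _ _ φ.continuous φ.hasCompactSupport,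
    timeInt_sub _ _ φ.continuous φ.hasCompactSupport]
  simp only [Submodule.coe_sub]
  obtain ⟨L, hL⟩ := exists_clm_eq_weakLHS (Ω := Ω) a k
    ((timeInt (deriv φ) u : V Ω) - (timeInt (deriv φ) u' : V Ω) : H10N Ω)
    ((timeInt φ u : V Ω) - (timeInt φ u' : V Ω) : H10N Ω)
    ((timeInt φ p : L2mod Ω) - (timeInt φ p' : L2mod Ω) : L2 (Ω : Set (E N)))
  rw [hL]
  -- The kernel of `L` is closed and contains all test functions, hence their closure `H₀¹(Ω)`.
  have hle : H10 Ω ≤ LinearMap.ker L.toLinearMap := by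
    refine Submodule.topologicalClosure_minimal _ ?_ L.isClosed_ker
    rintro _ ⟨η, rfl⟩
    change L (testGraph Ω η) = 0
    rw [← hL, weakLHS_sub, h.weakLHS_eq hΩ, h'.weakLHS_eq hΩ, sub_self]
  exact hle g.2

end Equation

/-! ### The cell problem in `L²(Z; L²(Y))` -/

section Cell

variable {N : ℕ}

theorem isBounded_cellY : Bornology.IsBounded (cellY N) := by
  refine (Metric.isBounded_closedBall (x := (0 : E N)) (r := Real.sqrt (∑ _i : Fin N, 1))).subset
    fun y hy => ?_
  rw [mem_closedBall_zero_iff, EuclideanSpace.norm_eq]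
  refine Real.sqrt_le_sqrt (Finset.sum_le_sum fun i _ => ?_)
  have h := hy i
  rw [Real.norm_eq_abs, sq_abs]
  nlinarith [h.1, h.2]

instance : IsFiniteMeasure (volume.restrict (cellY N)) :=
  ⟨by simpa using isBounded_cellY.measure_lt_top⟩

instance : IsProbabilityMeasure (volume.restrict cellZ) :=
  ⟨by simp [cellZ]; norm_num⟩

/-- Multiplication by an essentially bounded function on `L²(Y)`. -/
def mulL {b : E N → ℝ} (hb : MemLp b ∞ (volume : Measure (E N))) :
    L2 (cellY N) →L[ℝ] L2 (cellY N) :=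
  (ContinuousLinearMap.mul ℝ ℝ).holderL (volume.restrict (cellY N)) ∞ 2 2
    (hb.restrict (cellY N)).toLp

theorem coeFn_mulL {b : E N → ℝ} (hb : MemLp b ∞ (volume : Measure (E N))) (f : L2 (cellY N)) :
    mulL hb f =ᵐ[volume.restrict (cellY N)] fun y => b y * f y := by
  have h1 := ContinuousLinearMap.coeFn_holder (r := 2) (ContinuousLinearMap.mul ℝ ℝ)
    (hb.restrict (cellY N)).toLp f
  filter_upwards [h1, (hb.restrict (cellY N)).coeFn_toLp] with y hy hb
  exact hy.trans (by simp [hb])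

theorem inner_mulL {b : E N → ℝ} (hb : MemLp b ∞ (volume : Measure (E N))) (f g : L2 (cellY N)) :
    inner ℝ (mulL hb f) g = ∫ y in cellY N, b y * f y * g y := by
  rw [inner_L2]
  refine integral_congr_ae ?_
  filter_upwards [coeFn_mulL hb f] with y hy
  rw [hy]

/-- `w ↦ ∂w^k/∂y_j` as a continuous linear map. -/
def pdYL (N : ℕ) (k j : Fin N) : VY N →L[ℝ] L2 (cellY N) :=
  (PiLp.proj 2 (fun _ : Option (Fin N) => L2 (cellY N)) (some j)) ∘L (H1per N).subtypeL ∘L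
    (PiLp.proj 2 (fun _ : Fin N => H1per N) k) ∘L (VY N).subtypeL

/-- `L²(Z; L²(Y))`. -/
abbrev L2ZY (N : ℕ) : Type := Lp (L2 (cellY N)) 2 (volume.restrict cellZ)

/-- The partial derivative `∂w^k/∂y_j` of `w ∈ L²_per(Z; V_Y)`. -/
def gradZ (k j : Fin N) : L2perZ N →L[ℝ] L2ZY N := (pdYL N k j).compLpL 2 _

/-- Multiplication by an essentially bounded function of `y` on `L²(Z; L²(Y))`. -/
def mulZ {b : E N → ℝ} (hb : MemLp b ∞ (volume : Measure (E N))) : L2ZY N →L[ℝ] L2ZY N :=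
  (mulL hb).compLpL 2 _

/-- The constant function `1` in `L²(Y)`. -/
def oneY (N : ℕ) : L2 (cellY N) := Lp.const 2 _ 1

/-- The constant function `1` in `L²(Z; L²(Y))`. -/
def oneZ (N : ℕ) : L2ZY N := Lp.const 2 _ (oneY N)

theorem coeFn_oneY : oneY N =ᵐ[volume.restrict (cellY N)] fun _ => 1 := Lp.coeFn_const ..

theorem coeFn_oneZ : oneZ N =ᵐ[volume.restrict cellZ] fun _ => oneY N := Lp.coeFn_const ..

theorem coeFn_gradZ (k j : Fin N) (w : L2perZ N) :
    gradZ k j w =ᵐ[volume.restrict cellZ] fun τ => pdYL N k j (w τ) :=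
  (pdYL N k j).coeFn_compLpL w

theorem coeFn_mulZ {b : E N → ℝ} (hb : MemLp b ∞ (volume : Measure (E N))) (F : L2ZY N) :
    mulZ hb F =ᵐ[volume.restrict cellZ] fun τ => mulL hb (F τ) :=
  (mulL hb).coeFn_compLpL F

theorem inner_mulZ {b : E N → ℝ} (hb : MemLp b ∞ (volume : Measure (E N))) (F G : L2ZY N) :
    inner ℝ (mulZ hb F) G = ∫ τ in cellZ, inner ℝ (mulL hb (F τ)) (G τ) := by
  rw [L2.inner_def]
  refine integral_congr_ae ?_
  filter_upwards [coeFn_mulZ hb F] with τ hτ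
  rw [hτ]

/-- As inner products, the iterated integrals are bilinear and continuous in the fields, with no
separate integrability checks. -/
theorem inner_mulZ_gradZ_gradZ {b : E N → ℝ} (hb : MemLp b ∞ (volume : Measure (E N)))
    (u v : L2perZ N) (k j l i : Fin N) :
    inner ℝ (mulZ hb (gradZ k j u)) (gradZ l i v) =
      ∫ τ in cellZ, ∫ y in cellY N,
        b y * pdY (u τ : H1perN N) k j y * pdY (v τ : H1perN N) l i y := by
  rw [inner_mulZ]
  refine integral_congr_ae ?_
  filter_upwards [coeFn_gradZ k j u,
    coeFn_gradZ l i v] with τ h1 h2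
  exact (congrArg₂ (fun f g => inner ℝ (mulL hb f) g) h1 h2).trans (inner_mulL hb _ _)

theorem inner_mulZ_one_gradZ {b : E N → ℝ} (hb : MemLp b ∞ (volume : Measure (E N)))
    (v : L2perZ N) (l i : Fin N) :
    inner ℝ (mulZ hb (oneZ N)) (gradZ l i v) =
      ∫ τ in cellZ, ∫ y in cellY N, b y * pdY (v τ : H1perN N) l i y := by
  rw [inner_mulZ]
  refine integral_congr_ae ?_
  filter_upwards [coeFn_gradZ l i v,
    coeFn_oneZ (N := N)] with τ h1 h2
  refine (congrArg₂ (fun f g => inner ℝ (mulL hb f) g) h2 h1).trans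
    ((inner_mulL hb _ _).trans ?_)
  refine integral_congr_ae ?_
  filter_upwards [coeFn_oneY (N := N)] with y hy
  rw [hy, mul_one]
  rfl

theorem inner_mulZ_gradZ_one {b : E N → ℝ} (hb : MemLp b ∞ (volume : Measure (E N)))
    (v : L2perZ N) (l i : Fin N) :
    inner ℝ (mulZ hb (gradZ l i v)) (oneZ N) =
      ∫ τ in cellZ, ∫ y in cellY N, b y * pdY (v τ : H1perN N) l i y := by
  rw [inner_mulZ]
  refine integral_congr_ae ?_
  filter_upwards [coeFn_gradZ l i v,
    coeFn_oneZ (N := N)] with τ h1 h2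
  refine (congrArg₂ (fun f g => inner ℝ (mulL hb f) g) h1 h2).trans
    ((inner_mulL hb _ _).trans ?_)
  refine integral_congr_ae ?_
  filter_upwards [coeFn_oneY (N := N)] with y hy
  rw [hy, mul_one]
  rfl

/-- The cell `Z` has length one, so the integration in `τ` drops out. -/
theorem inner_mulZ_one_one {b : E N → ℝ} (hb : MemLp b ∞ (volume : Measure (E N))) :
    inner ℝ (mulZ hb (oneZ N)) (oneZ N) = ∫ y in cellY N, b y := by
  rw [inner_mulZ]
  have h : ∀ᵐ τ ∂(volume.restrict cellZ),
      inner ℝ (mulL hb (oneZ N τ)) (oneZ N τ) = ∫ y in cellY N, b y := by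
    filter_upwards [coeFn_oneZ (N := N)] with τ h2
    rw [h2, inner_mulL]
    refine integral_congr_ae ?_
    filter_upwards [coeFn_oneY (N := N)] with y hy
    rw [hy, mul_one, mul_one]
  rw [integral_congr_ae h]
  simp

/-- The pointwise inequality is applied at almost every `y` with `ζ = (f_i(y))`, then integrated. -/
theorem sum_inner_mulL_nonneg {a : Fin N → Fin N → E N → ℝ}
    (ha : ∀ i j, MemLp (a i j) ∞ (volume : Measure (E N)))
    (hell : ∀ᵐ y : E N, ∀ ζ : E N, 0 ≤ ∑ i, ∑ j, a i j y * ζ j * ζ i)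
    (f : Fin N → L2 (cellY N)) :
    0 ≤ ∑ i, ∑ j, inner ℝ (mulL (ha i j) (f j)) (f i) := by
  have hint : ∀ i j, Integrable (fun y => a i j y * f j y * f i y)
      (volume.restrict (cellY N)) := fun i j => by
    refine (L2.integrable_inner (𝕜 := ℝ) (mulL (ha i j) (f j)) (f i)).congr ?_
    filter_upwards [coeFn_mulL (ha i j) (f j)] with y hy
    rw [hy]
    simp [mul_comm]
  simp only [inner_mulL]
  simp only [← integral_finsetSum _ fun j _ => hint _ j]
  rw [← integral_finsetSum _ fun i _ => integrable_finsetSum _ fun j _ => hint i j]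
  refine integral_nonneg_of_ae ?_
  filter_upwards [ae_restrict_of_ae hell] with y hy
  exact hy (WithLp.toLp 2 fun i => f i y)

theorem sum_inner_mulZ_nonneg {a : Fin N → Fin N → E N → ℝ}
    (ha : ∀ i j, MemLp (a i j) ∞ (volume : Measure (E N)))
    (hell : ∀ᵐ y : E N, ∀ ζ : E N, 0 ≤ ∑ i, ∑ j, a i j y * ζ j * ζ i)
    (F : Fin N → L2ZY N) :
    0 ≤ ∑ i, ∑ j, inner ℝ (mulZ (ha i j) (F j)) (F i) := by
  have hint : ∀ i j, Integrable (fun τ => inner ℝ (mulL (ha i j) (F j τ)) (F i τ))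
      (volume.restrict cellZ) := fun i j => by
    refine (L2.integrable_inner (𝕜 := ℝ) (mulZ (ha i j) (F j)) (F i)).congr ?_
    filter_upwards [coeFn_mulZ (ha i j) (F j)] with τ hτ
    rw [hτ]
  simp only [inner_mulZ]
  simp only [← integral_finsetSum _ fun j _ => hint _ j]
  rw [← integral_finsetSum _ fun i _ => integrable_finsetSum _ fun j _ => hint i j]
  exact integral_nonneg fun τ => sum_inner_mulL_nonneg ha hell fun i => F i τ

theorem aHat_eq {a : Fin N → Fin N → E N → ℝ}
    (ha : ∀ i j, MemLp (a i j) ∞ (volume : Measure (E N))) (u v : L2perZ N) :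
    aHat a u v = ∑ i, ∑ j, ∑ k, inner ℝ (mulZ (ha i j) (gradZ k j u)) (gradZ k i v) := by
  simp only [aHat, inner_mulZ_gradZ_gradZ]

attribute [irreducible] mulZ gradZ oneZ

end Cell

/-! ### Nonnegativity of the homogenized coefficients -/

section Homogenized

variable {N : ℕ} {a : Fin N → Fin N → E N → ℝ}

/-- The combination `∑_{j,h} z_{jh} χ_{jh}` of the correctors. -/
def correctorComb (a : Fin N → Fin N → E N → ℝ) (z : Fin N → Fin N → ℝ) : L2perZ N :=
  ∑ j, ∑ h, z j h • corrector a j h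

/-- `â(·, w)` as a continuous linear functional. -/
def aHatL (ha : ∀ i j, MemLp (a i j) ∞ (volume : Measure (E N))) (w : L2perZ N) :
    L2perZ N →L[ℝ] ℝ :=
  ∑ i, ∑ j, ∑ k, innerSL ℝ (gradZ k i w) ∘L mulZ (ha i j) ∘L gradZ k j

theorem aHatL_apply (ha : ∀ i j, MemLp (a i j) ∞ (volume : Measure (E N))) (u w : L2perZ N) :
    aHatL ha w u = aHat a u w := by
  rw [aHat_eq ha]
  simp only [aHatL, _root_.sum_apply, ContinuousLinearMap.comp_apply, innerSL_apply_apply]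
  refine Finset.sum_congr rfl fun i _ => Finset.sum_congr rfl fun j _ =>
    Finset.sum_congr rfl fun k _ => real_inner_comm _ _

/-- The average of the flux of `u` as a continuous linear functional. -/
def fluxL (ha : ∀ i j, MemLp (a i j) ∞ (volume : Measure (E N))) (i k : Fin N) :
    L2perZ N →L[ℝ] ℝ :=
  ∑ l, innerSL ℝ (oneZ N) ∘L mulZ (ha i l) ∘L gradZ k l

theorem fluxL_apply (ha : ∀ i j, MemLp (a i j) ∞ (volume : Measure (E N))) (i k : Fin N)
    (u : L2perZ N) :
    fluxL ha i k u = ∑ l, inner ℝ (mulZ (ha i l) (gradZ k l u)) (oneZ N) := by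
  simp only [fluxL, _root_.sum_apply, ContinuousLinearMap.comp_apply, innerSL_apply_apply]
  exact Finset.sum_congr rfl fun l _ => real_inner_comm _ _

theorem q_eq (ha : ∀ i j, MemLp (a i j) ∞ (volume : Measure (E N))) (i j k h : Fin N) :
    q a i j k h = (if k = h then inner ℝ (mulZ (ha i j) (oneZ N)) (oneZ N) else 0) -
      fluxL ha i k (corrector a j h) := by
  rw [fluxL_apply, q, inner_mulZ_one_one]
  simp only [inner_mulZ_gradZ_one, ite_mul, one_mul, zero_mul]

/-- The field `z - ∇_y χ_z`; the transposed matrix `z` stands for a constant gradient. -/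
def cellField (a : Fin N → Fin N → E N → ℝ) (z : Fin N → Fin N → ℝ) (j k : Fin N) : L2ZY N :=
  z j k • oneZ N - gradZ k j (correctorComb a z)

theorem inner_mulZ_cellField (ha : ∀ i j, MemLp (a i j) ∞ (volume : Measure (E N)))
    (z : Fin N → Fin N → ℝ) (i j k : Fin N) (G : L2ZY N) :
    inner ℝ (mulZ (ha i j) (cellField a z j k)) G =
      z j k * inner ℝ (mulZ (ha i j) (oneZ N)) G -
        inner ℝ (mulZ (ha i j) (gradZ k j (correctorComb a z))) G := by
  rw [cellField, map_sub, map_smul, inner_sub_left, real_inner_smul_left]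

/-- By linearity of `â` in its first argument, the cell problems add up with weights `z j k`. -/
theorem aHat_correctorComb (ha : ∀ i j, MemLp (a i j) ∞ (volume : Measure (E N)))
    (hsol : ∀ i k, SolvesCell a i k (corrector a i k)) (z : Fin N → Fin N → ℝ) (w : L2perZ N) :
    aHat a (correctorComb a z) w = ∑ j, ∑ k, z j k *
      ∑ i, inner ℝ (mulZ (ha i j) (oneZ N)) (gradZ k i w) := by
  rw [← aHatL_apply ha, correctorComb]
  simp only [map_sum, map_smul, smul_eq_mul, aHatL_apply]
  refine Finset.sum_congr rfl fun j _ => Finset.sum_congr rfl fun k _ => ?_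
  rw [hsol j k w]
  simp only [inner_mulZ_one_gradZ]

/-- The equation of `correctorComb a z` tested with `correctorComb a z` itself. -/
theorem cellField_orthogonal (ha : ∀ i j, MemLp (a i j) ∞ (volume : Measure (E N)))
    (z : Fin N → Fin N → ℝ) :
    ∑ i, ∑ j, ∑ k, inner ℝ (mulZ (ha i j) (cellField a z j k))
      (gradZ k i (correctorComb a z)) = 0 := by
  -- If no family of solutions existed, `corrector` would be its default value `0` and the identity
  -- would be trivial. Solvability of the cell problems therefore need not be established.
  by_cases h : ∃ χ : Fin N → Fin N → L2perZ N, ∀ i k, SolvesCell a i k (χ i k)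
  · have hsol : ∀ i k, SolvesCell a i k (corrector a i k) := by
      rw [corrector, dif_pos h]
      exact h.choose_spec
    simp only [inner_mulZ_cellField, Finset.sum_sub_distrib]
    rw [← aHat_eq ha, aHat_correctorComb ha hsol, Finset.sum_comm, sub_eq_zero]
    refine Finset.sum_congr rfl fun j _ => ?_
    rw [Finset.sum_comm]
    simp only [Finset.mul_sum]
  · have h0 : correctorComb a z = 0 := by
      rw [correctorComb, corrector, dif_neg h]
      simp
    simp [h0]

/-- The homogenized quadratic form is the energy of the field `z - ∇_y χ_z`. -/
theorem sum_q_eq (ha : ∀ i j, MemLp (a i j) ∞ (volume : Measure (E N)))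
    (z : Fin N → Fin N → ℝ) :
    ∑ i, ∑ j, ∑ k, ∑ h, q a i j k h * z j h * z i k =
      ∑ i, ∑ j, ∑ k, inner ℝ (mulZ (ha i j) (cellField a z j k)) (cellField a z i k) := by
  have h1 : ∀ i j k, inner ℝ (mulZ (ha i j) (cellField a z j k)) (cellField a z i k) =
      z i k * inner ℝ (mulZ (ha i j) (cellField a z j k)) (oneZ N) -
        inner ℝ (mulZ (ha i j) (cellField a z j k)) (gradZ k i (correctorComb a z)) :=
    fun i j k => by
      conv_lhs => rw [cellField.eq_def a z i k]
      rw [inner_sub_right, real_inner_smul_right]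
  have h3 : ∀ i k, ∑ j, inner ℝ (mulZ (ha i j) (gradZ k j (correctorComb a z))) (oneZ N) =
      ∑ j, ∑ h, z j h * fluxL ha i k (corrector a j h) := fun i k => by
    rw [← fluxL_apply, correctorComb]
    simp only [map_sum, map_smul, smul_eq_mul]
  simp only [h1, Finset.sum_sub_distrib]
  -- Orthogonality removes the corrector from the second factor; what remains is the averaged flux
  -- of `z - ∇_y χ_z` paired with `z`, which is linear in `z` with coefficients `q`.
  rw [cellField_orthogonal ha, sub_zero]
  refine Finset.sum_congr rfl fun i _ => ?_
  rw [Finset.sum_comm]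
  conv_rhs => rw [Finset.sum_comm]
  refine Finset.sum_congr rfl fun k _ => ?_
  rw [← Finset.mul_sum]
  simp only [inner_mulZ_cellField, Finset.sum_sub_distrib]
  rw [h3, mul_sub, Finset.mul_sum, Finset.mul_sum, ← Finset.sum_sub_distrib]
  refine Finset.sum_congr rfl fun j _ => ?_
  simp only [q_eq ha, sub_mul, Finset.sum_sub_distrib, ite_mul, zero_mul, Finset.sum_ite_eq,
    Finset.mem_univ, if_true]
  rw [Finset.mul_sum]
  congr 1
  · ring
  · exact Finset.sum_congr rfl fun h _ => by ring

/-- The energy of `z - ∇_y χ_z` decouples over the components `k`, and each one contributes a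
nonnegative scalar energy. -/
theorem sum_q_nonneg (ha : ∀ i j, MemLp (a i j) ∞ (volume : Measure (E N)))
    (hell : ∀ᵐ y : E N, ∀ ζ : E N, 0 ≤ ∑ i, ∑ j, a i j y * ζ j * ζ i) (z : Fin N → Fin N → ℝ) :
    0 ≤ ∑ i, ∑ j, ∑ k, ∑ h, q a i j k h * z j h * z i k := by
  rw [sum_q_eq ha]
  have h1 : ∑ i, ∑ j, ∑ k, inner ℝ (mulZ (ha i j) (cellField a z j k)) (cellField a z i k) =
      ∑ k, ∑ i, ∑ j, inner ℝ (mulZ (ha i j) (cellField a z j k)) (cellField a z i k) := by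
    rw [Finset.sum_comm' (t' := Finset.univ) (s' := fun _ => Finset.univ) (by simp)]
    conv_rhs => rw [Finset.sum_comm]
    conv_lhs => rw [Finset.sum_comm]
    exact Finset.sum_congr rfl fun i _ => Finset.sum_comm
  rw [h1]
  exact Finset.sum_nonneg fun k _ => sum_inner_mulZ_nonneg ha hell fun j => cellField a z j k

end Homogenized

/-! ### Vanishing of the velocity -/

section Energy

variable {N : ℕ} {Ω : Opens (E N)} {T : ℝ}

/-- The homogenized bilinear form `(u, v) ↦ ∑ ∫_Ω q_{ijkh} ∂_j u^h ∂_i v^k` as a functional of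
`u`. -/
def formL (a : Fin N → Fin N → E N → ℝ) (v : H10N Ω) : H10N Ω →L[ℝ] ℝ :=
  ∑ k, qL Ω a k (v k : H1Amb (Ω : Set (E N)))

/-- The `L²(Ω)^N` inner product as a functional of the first variable. -/
def massL (v : H10N Ω) : H10N Ω →L[ℝ] ℝ := ∑ k, innerSL ℝ (comp v k) ∘L compL Ω k

theorem massL_apply (v u : H10N Ω) : massL v u = ∑ k, inner ℝ (comp u k) (comp v k) := by
  simp only [massL, _root_.sum_apply, ContinuousLinearMap.comp_apply, innerSL_apply_apply,
    compL_apply]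
  exact Finset.sum_congr rfl fun k _ => real_inner_comm _ _

theorem formL_apply (a : Fin N → Fin N → E N → ℝ) (v u : H10N Ω) :
    formL a v u = ∑ k, ∑ i, ∑ j, ∑ l, q a i j k l * inner ℝ (pd u l j) (pd v k i) := by
  simp only [formL, _root_.sum_apply, qL_apply]
  rfl

/-- The matrix inequality is applied at each `x` with `z_{jh} = ∂_j v^h(x)`, then integrated over
`Ω`. -/
theorem formL_self_nonneg {a : Fin N → Fin N → E N → ℝ}
    (hq : ∀ z : Fin N → Fin N → ℝ, 0 ≤ ∑ i, ∑ j, ∑ k, ∑ h, q a i j k h * z j h * z i k)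
    (v : H10N Ω) : 0 ≤ formL a v v := by
  have hint : ∀ k i j l, Integrable (fun x => q a i j k l * (pd v l j x * pd v k i x))
      (volume.restrict (Ω : Set (E N))) := fun k i j l => by
    refine Integrable.const_mul ?_ _
    refine (L2.integrable_inner (𝕜 := ℝ) (pd v l j) (pd v k i)).congr
      (Filter.Eventually.of_forall fun x => ?_)
    simp [mul_comm]
  have h1 : formL a v v = ∫ x in (Ω : Set (E N)), ∑ k, ∑ i, ∑ j, ∑ l,
      q a i j k l * (pd v l j x * pd v k i x) := by
    rw [formL_apply, integral_finsetSum _ fun k _ => integrable_finsetSum _ fun i _ =>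
      integrable_finsetSum _ fun j _ => integrable_finsetSum _ fun l _ => hint k i j l]
    refine Finset.sum_congr rfl fun k _ => ?_
    rw [integral_finsetSum _ fun i _ =>
      integrable_finsetSum _ fun j _ => integrable_finsetSum _ fun l _ => hint k i j l]
    refine Finset.sum_congr rfl fun i _ => ?_
    rw [integral_finsetSum _ fun j _ => integrable_finsetSum _ fun l _ => hint k i j l]
    refine Finset.sum_congr rfl fun j _ => ?_
    rw [integral_finsetSum _ fun l _ => hint k i j l]
    refine Finset.sum_congr rfl fun l _ => ?_
    rw [inner_L2, integral_const_mul]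
  rw [h1]
  refine integral_nonneg fun x => ?_
  refine (hq fun j h => pd v h j x).trans_eq ?_
  conv_rhs => rw [Finset.sum_comm]
  refine Finset.sum_congr rfl fun i _ => ?_
  rw [Finset.sum_comm]
  simp only [mul_assoc]

/-- Testing with a solenoidal field eliminates the pressure. -/
theorem massL_timeInt_deriv {a : Fin N → Fin N → E N → ℝ} {φ : ℝ → ℝ} {U : L2T T (V Ω)}
    {π : L2 (Ω : Set (E N))}
    (h : ∀ (k : Fin N) (g : H10 Ω), weakLHS Ω a k (timeInt (deriv φ) U : V Ω)
      (timeInt φ U : V Ω) π g = 0) (v : V Ω) :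
    massL (v : H10N Ω) (timeInt (deriv φ) U : V Ω) = formL a (v : H10N Ω) (timeInt φ U : V Ω) := by
  -- The components of `v` lie in `H₀¹(Ω)` and are admissible one by one, so density of solenoidal
  -- test functions in `V` is not needed. In the sum over `k` the pressure meets `div v = 0`.
  have h1 : ∑ k, weakLHS Ω a k (timeInt (deriv φ) U : V Ω) (timeInt φ U : V Ω) π
      ((v : H10N Ω) k) = 0 := Finset.sum_eq_zero fun k _ => h k _
  have h2 : ∑ k, inner ℝ π (pd (v : H10N Ω) k k) = 0 := by
    rw [← inner_sum, show ∑ k, pd (v : H10N Ω) k k = 0 from v.2, inner_zero_right]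
  simp only [weakLHS, Finset.sum_add_distrib, Finset.sum_sub_distrib, Finset.sum_neg_distrib] at h1
  rw [massL_apply, formL_apply]
  change -∑ k, inner ℝ (comp (timeInt (deriv φ) U : V Ω) k) (comp (v : H10N Ω) k) +
    ∑ k, ∑ i, ∑ j, ∑ l, q a i j k l * inner ℝ (pd (timeInt φ U : V Ω) l j) (pd (v : H10N Ω) k i) -
    ∑ k, inner ℝ π (pd (v : H10N Ω) k k) = 0 at h1
  linarith

theorem locallyIntegrableOn_L2 (f : L2 (Ω : Set (E N))) :
    LocallyIntegrableOn f (Ω : Set (E N)) := by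
  rw [locallyIntegrableOn_iff Ω.isOpen.isLocallyClosed]
  intro K hKΩ hK
  have h2 : MemLp f 2 (volume.restrict K) := (Lp.memLp f).mono_measure (Measure.restrict_mono hKΩ le_rfl)
  have : IsFiniteMeasure (volume.restrict K) := ⟨by simpa using hK.measure_lt_top⟩
  exact h2.integrable one_le_two

theorem inner_testGraph_testGraph (ψ η : 𝓓(Ω, ℝ)) (i : Fin N) :
    inner ℝ (coord (testGraph Ω ψ) (some i)) (coord (testGraph Ω η) none) =
      -inner ℝ (coord (testGraph Ω ψ) none) (coord (testGraph Ω η) (some i)) := by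
  have hsupp : ∀ x ∉ (Ω : Set (E N)), ψ x = 0 := fun x hx =>
    Function.notMem_support.1 fun h => hx (ψ.tsupport_subset (subset_tsupport _ h))
  have hsupp' : ∀ x ∉ (Ω : Set (E N)), η x = 0 := fun x hx =>
    Function.notMem_support.1 fun h => hx (η.tsupport_subset (subset_tsupport _ h))
  have hcd : ∀ ζ : 𝓓(Ω, ℝ), Continuous fun x => fderiv ℝ ζ x (e i) := fun ζ =>
    (ζ.contDiff.continuous_fderiv (by simp)).clm_apply continuous_const
  have hcc : ∀ ζ : 𝓓(Ω, ℝ), HasCompactSupport fun x => fderiv ℝ ζ x (e i) := fun ζ =>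
    ζ.hasCompactSupport.fderiv_apply ℝ (e i)
  have hibp := integral_mul_fderiv_eq_neg_fderiv_mul_of_integrable (𝕜 := ℝ) (μ := volume)
    (f := ψ) (g := η) (v := (e i : E N))
    (((hcd ψ).mul η.continuous).integrable_of_hasCompactSupport (hcc ψ).mul_right)
    ((ψ.continuous.mul (hcd η)).integrable_of_hasCompactSupport ψ.hasCompactSupport.mul_right)
    ((ψ.continuous.mul η.continuous).integrable_of_hasCompactSupport
      ψ.hasCompactSupport.mul_right)
    (fun x _ => ψ.contDiff.differentiable (by simp) x)
    (fun x _ => η.contDiff.differentiable (by simp) x)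
  have h1 : ∀ o o', inner ℝ (coord (testGraph Ω ψ) o) (coord (testGraph Ω η) o') =
      ∫ x in (Ω : Set (E N)), testComp ψ o x * testComp η o' x := fun o o' => by
    rw [inner_testGraph]
    refine integral_congr_ae ?_
    filter_upwards [(testComp_memLp ψ o).coeFn_toLp] with x hx
    rw [coord_testGraph, hx]
  rw [h1, h1]
  change ∫ x in (Ω : Set (E N)), fderiv ℝ ψ x (e i) * η x =
    -∫ x in (Ω : Set (E N)), ψ x * fderiv ℝ η x (e i)
  rw [setIntegral_eq_integral_of_forall_compl_eq_zero fun x hx => by simp [hsupp' x hx],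
    setIntegral_eq_integral_of_forall_compl_eq_zero fun x hx => by simp [hsupp x hx], hibp, neg_neg]

/-- The components `some i` of an element of `H₀¹(Ω)` are the weak partial derivatives of its
component `none`. -/
theorem coord_some_testGraph (g : H10 Ω) (η : 𝓓(Ω, ℝ)) (i : Fin N) :
    inner ℝ (coord (g : H1Amb (Ω : Set (E N))) (some i)) (coord (testGraph Ω η) none) =
      -inner ℝ (coord (g : H1Amb (Ω : Set (E N))) none) (coord (testGraph Ω η) (some i)) := by
  let P : Option (Fin N) → H1Amb (Ω : Set (E N)) →L[ℝ] L2 (Ω : Set (E N)) :=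
    fun o => PiLp.proj 2 (fun _ => L2 (Ω : Set (E N))) o
  let L : H1Amb (Ω : Set (E N)) →L[ℝ] ℝ :=
    innerSL ℝ (coord (testGraph Ω η) none) ∘L P (some i) +
      innerSL ℝ (coord (testGraph Ω η) (some i)) ∘L P none
  have hL : ∀ h, L h = inner ℝ (coord h (some i)) (coord (testGraph Ω η) none) +
      inner ℝ (coord h none) (coord (testGraph Ω η) (some i)) := fun h => by
    rw [real_inner_comm, real_inner_comm (coord (testGraph Ω η) (some i))]
    rfl
  have hle : H10 Ω ≤ LinearMap.ker L.toLinearMap := by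
    refine Submodule.topologicalClosure_minimal _ ?_ L.isClosed_ker
    rintro _ ⟨ψ, rfl⟩
    change L (testGraph Ω ψ) = 0
    rw [hL, inner_testGraph_testGraph, neg_add_cancel]
  have h0 : L g = 0 := hle g.2
  rw [hL] at h0
  linarith

/-- A function in `H₀¹(Ω)` which vanishes in `L²(Ω)` has zero gradient. -/
theorem H10_eq_zero {g : H10 Ω} (hg : coord (g : H1Amb (Ω : Set (E N))) none = 0) : g = 0 := by
  -- The closure of the graph could a priori contain a pair with zero function and nonzero gradient.
  -- The weak derivative identity excludes this: such a gradient is orthogonal to every test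
  -- function.
  have hgrad : ∀ i, coord (g : H1Amb (Ω : Set (E N))) (some i) = 0 := fun i => by
    have hloc : LocallyIntegrableOn (coord (g : H1Amb (Ω : Set (E N))) (some i))
        (Ω : Set (E N)) := locallyIntegrableOn_L2 _
    rw [Lp.eq_zero_iff_ae_eq_zero, Filter.EventuallyEq, ae_restrict_iff' Ω.isOpen.measurableSet]
    refine Ω.isOpen.ae_eq_zero_of_integral_contDiff_smul_eq_zero hloc fun η hη hηc hηs => ?_
    have h1 := coord_some_testGraph g ⟨η, hη, hηc, hηs⟩ i
    rw [hg, inner_zero_left, neg_zero, inner_testGraph] at h1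
    rw [← h1, ← setIntegral_eq_integral_of_forall_compl_eq_zero (s := (Ω : Set (E N)))]
    · exact integral_congr_ae (Filter.Eventually.of_forall fun x => mul_comm _ _)
    · intro x hx
      rw [Function.notMem_support.1 fun h => hx (hηs (subset_tsupport _ h)), zero_smul]
  apply Subtype.ext
  apply PiLp.ext
  rintro (_ | i)
  · exact hg
  · exact hgrad i

theorem eq_zero_of_comp_eq_zero {v : V Ω} (h : ∀ k, comp (v : H10N Ω) k = 0) : v = 0 := by
  apply Subtype.ext
  apply PiLp.ext
  intro k
  exact H10_eq_zero (h k)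

/-- The energy argument: the primitive of `U` decreases in `L²(Ω)`. -/
theorem eq_zero_of_weak_equation (hT : 0 < T) {a : Fin N → Fin N → E N → ℝ}
    (hq : ∀ v : H10N Ω, 0 ≤ formL a v v) {U : L2T T (V Ω)}
    (hU : ∀ (v : V Ω) (φ : 𝓓(timeInterval T, ℝ)),
      massL (v : H10N Ω) (timeInt (deriv φ) U : V Ω) = formL a (v : H10N Ω) (timeInt φ U : V Ω))
    {w : ℝ → Fin N → L2 (Ω : Set (E N))} (hw : ContinuousOn w (Icc 0 T)) (hw0 : w 0 = 0)
    (hwU : ∀ᵐ t ∂(volume.restrict (Ioo 0 T)), ∀ k, w t k = comp (U t : H10N Ω) k) :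
    U = 0 := by
  have hUi : IntervalIntegrable U volume 0 T := by
    rw [intervalIntegrable_iff_integrableOn_Ioo_of_le hT.le]
    exact L2T.integrable U
  have hUt : ∀ t ∈ Icc 0 T, IntervalIntegrable U volume 0 t := fun t ht =>
    hUi.mono_set (by rw [uIcc_of_le hT.le, uIcc_of_le ht.1]; exact Icc_subset_Icc_right ht.2)
  have hwk : ∀ k, ContinuousOn (fun t => w t k) (Icc 0 T) := fun k =>
    (continuous_apply k).comp_continuousOn hw
  -- For each fixed `t` this primitive is an element of `V`, hence an admissible test field.
  let P : ℝ → V Ω := fun t => ∫ s in (0 : ℝ)..t, U s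
  -- For fixed `v`, the weak derivative of `(w(t), v)` is `-form(U(t), v)`; continuity of `w` and `w
  -- 0 = 0` permit integration from time `0`.
  have hmass : ∀ t ∈ Icc 0 T, ∀ v : V Ω,
      ∑ k, inner ℝ (w t k) (comp (v : H10N Ω) k) = -formL a (v : H10N Ω) (P t) := by
    intro t ht v
    have hP : formL a (v : H10N Ω) (P t) =
        ∫ s in (0 : ℝ)..t, formL a (v : H10N Ω) (U s : H10N Ω) :=
      (((formL a (v : H10N Ω)) ∘L (V Ω).subtypeL).intervalIntegral_comp_comm (hUt t ht)).symm
    rw [hP, ← intervalIntegral.integral_neg]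
    refine eq_intervalIntegral_of_weak_deriv hT
      (f := fun t => ∑ k, inner ℝ (w t k) (comp (v : H10N Ω) k))
      (g := fun s => -formL a (v : H10N Ω) (U s : H10N Ω)) ?_ ?_ ?_ ?_ t ht
    · exact continuousOn_finsetSum _ fun k _ => (hwk k).inner continuousOn_const
    · simp [hw0]
    · exact (((formL a (v : H10N Ω)) ∘L (V Ω).subtypeL).integrable_comp
        (L2T.integrable U)).neg
    · intro φ
      have h1 := hU v φ
      rw [clm_timeInt_V _ U (φ.contDiff.continuous_deriv (by simp)) φ.hasCompactSupport.deriv,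
        clm_timeInt_V _ U φ.continuous φ.hasCompactSupport] at h1
      simp only [mul_neg, integral_neg, neg_neg]
      rw [← h1]
      refine integral_congr_ae ?_
      filter_upwards [hwU] with s hs
      simp only [massL_apply, hs]
  have hPk : ∀ t ∈ Icc 0 T, ∀ k, comp (P t : H10N Ω) k = ∫ s in (0 : ℝ)..t, w s k := by
    intro t ht k
    have h1 : comp (P t : H10N Ω) k = ∫ s in (0 : ℝ)..t, comp (U s : H10N Ω) k :=
      ((compL Ω k ∘L (V Ω).subtypeL).intervalIntegral_comp_comm (hUt t ht)).symm
    rw [h1]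
    refine intervalIntegral.integral_congr_ae_restrict ?_
    rw [uIoc_of_le ht.1]
    have hwU' : ∀ᵐ s ∂(volume.restrict (Ioc 0 T)), ∀ k, w s k = comp (U s : H10N Ω) k := by
      rw [← restrict_Ioo_eq_restrict_Ioc]
      exact hwU
    filter_upwards [ae_restrict_of_ae_restrict_of_subset (Ioc_subset_Ioc_right ht.2) hwU'] with s hs
    exact (hs k).symm
  -- The components of `P` are rewritten as primitives of the continuous representative `w`, so they
  -- are differentiable at every point of `]0,T[`.
  let Y : Fin N → ℝ → L2 (Ω : Set (E N)) := fun k t => ∫ s in (0 : ℝ)..t, w s k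
  have hwi : ∀ k, IntervalIntegrable (fun s => w s k) volume 0 T := fun k =>
    ContinuousOn.intervalIntegrable (by rw [uIcc_of_le hT.le]; exact hwk k)
  have hYc : ∀ k, ContinuousOn (Y k) (Icc 0 T) := fun k => by
    have := intervalIntegral.continuousOn_primitive_interval' (hwi k) (left_mem_uIcc (b := T))
    rwa [uIcc_of_le hT.le] at this
  have hYd : ∀ k, ∀ t ∈ Ioo 0 T, HasDerivAt (Y k) (w t k) t := fun k t ht => by
    refine intervalIntegral.integral_hasDerivAt_right ?_ ?_ ?_
    · exact (hwi k).mono_set (by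
        rw [uIcc_of_le hT.le, uIcc_of_le ht.1.le]; exact Icc_subset_Icc_right ht.2.le)
    · exact ContinuousOn.stronglyMeasurableAtFilter isOpen_Ioo
        ((hwk k).mono Ioo_subset_Icc_self) t ht
    · exact ((hwk k).mono Ioo_subset_Icc_self).continuousAt (isOpen_Ioo.mem_nhds ht)
  let F : ℝ → ℝ := fun t => ∑ k, ‖Y k t‖ ^ 2
  have hFd : ∀ t ∈ Ioo 0 T, HasDerivAt F (∑ k, 2 * inner ℝ (Y k t) (w t k)) t := fun t ht =>
    HasDerivAt.fun_sum fun k _ => (hYd k t ht).norm_sq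
  have hFanti : AntitoneOn F (Icc 0 T) := by
    refine antitoneOn_of_deriv_nonpos (convex_Icc 0 T)
      (continuousOn_finsetSum _ fun k _ => (hYc k).norm.pow 2) ?_ ?_
    · rw [interior_Icc]
      exact fun t ht => (hFd t ht).differentiableAt.differentiableWithinAt
    · rw [interior_Icc]
      intro t ht
      have htc := Ioo_subset_Icc_self ht
      rw [(hFd t ht).deriv, ← Finset.mul_sum]
      -- This is the integrated equation at time `t`, tested with `v = P t`.
      have h1 : ∑ k, inner ℝ (Y k t) (w t k) = -formL a (P t : H10N Ω) (P t : H10N Ω) := by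
        rw [← hmass t htc (P t)]
        refine Finset.sum_congr rfl fun k _ => ?_
        rw [hPk t htc k, real_inner_comm]
      rw [h1]
      linarith [hq (P t)]
  have hY0 : ∀ t ∈ Icc 0 T, ∀ k, Y k t = 0 := by
    intro t ht k
    have h1 : F t ≤ F 0 := hFanti (left_mem_Icc.2 hT.le) ht ht.1
    have h2 : F 0 = 0 := by simp [F, Y]
    have h3 : ‖Y k t‖ ^ 2 ≤ F t :=
      Finset.single_le_sum (f := fun k => ‖Y k t‖ ^ 2) (fun k _ => by positivity)
        (Finset.mem_univ k)
    have h4 : ‖Y k t‖ ^ 2 = 0 := le_antisymm (by linarith) (by positivity)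
    simpa using h4
  -- The derivative of `Y k = 0` is `w`.
  have hw_zero : ∀ t ∈ Ioo 0 T, ∀ k, w t k = 0 := by
    intro t ht k
    refine (hYd k t ht).unique ((hasDerivAt_const t (0 : L2 (Ω : Set (E N)))).congr_of_eventuallyEq ?_)
    filter_upwards [isOpen_Ioo.mem_nhds ht] with s hs
    exact hY0 s (Ioo_subset_Icc_self hs) k
  rw [Lp.eq_zero_iff_ae_eq_zero]
  filter_upwards [hwU, ae_restrict_mem measurableSet_Ioo] with t h1 ht
  exact eq_zero_of_comp_eq_zero fun k => by rw [← h1 k, hw_zero t ht k]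

end Energy

/-! ### Vanishing of the pressure -/

section Pressure

variable {N : ℕ} {Ω : Opens (E N)} {T : ℝ}

/-- An element of `L²(Ω)/ℝ` with zero distributional gradient on a connected `Ω` vanishes. -/
theorem L2mod_eq_zero (hΩb : Bornology.IsBounded (Ω : Set (E N)))
    (hΩc : IsConnected (Ω : Set (E N))) {π : L2mod Ω}
    (h : ∀ (η : 𝓓(Ω, ℝ)) (k : Fin N),
      inner ℝ (π : L2 (Ω : Set (E N))) (coord (testGraph Ω η) (some k)) = 0) : π = 0 := by
  have hgrad : ∀ g : E N → ℝ, ContDiff ℝ ∞ g → HasCompactSupport g → tsupport g ⊆ Ω →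
      ∀ v, ∫ y, (π : L2 (Ω : Set (E N))) y * fderiv ℝ g y v = 0 := by
    intro g hg hgc hgs v
    have hv : v = ∑ k, v k • (e k : E N) := by
      ext i
      simp [Pi.single_apply]
    have h0 : ∀ y ∉ (Ω : Set (E N)), fderiv ℝ g y = 0 := fun y hy =>
      Function.notMem_support.1 fun hs => hy (hgs (support_fderiv_subset ℝ hs))
    have hint : ∀ k, Integrable (fun y => (π : L2 (Ω : Set (E N))) y *
        testComp g (some k) y) (volume.restrict (Ω : Set (E N))) := fun k =>
      (Lp.memLp (π : L2 (Ω : Set (E N)))).integrable_mul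
        (testComp_memLp (⟨g, hg, hgc, hgs⟩ : 𝓓(Ω, ℝ)) (some k))
    rw [← setIntegral_eq_integral_of_forall_compl_eq_zero (s := (Ω : Set (E N)))
      fun y hy => by simp [h0 y hy]]
    have h1 : ∀ y, (π : L2 (Ω : Set (E N))) y * fderiv ℝ g y v =
        ∑ k, v k * ((π : L2 (Ω : Set (E N))) y * testComp g (some k) y) := fun y => by
      conv_lhs => rw [hv, map_sum]
      rw [Finset.mul_sum]
      refine Finset.sum_congr rfl fun k _ => ?_
      rw [map_smul, smul_eq_mul, testComp]
      ring
    simp only [h1]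
    rw [integral_finsetSum _ fun k _ => (hint k).const_mul _]
    refine Finset.sum_eq_zero fun k _ => ?_
    rw [integral_const_mul]
    have h2 := h ⟨g, hg, hgc, hgs⟩ k
    rw [inner_testGraph] at h2
    exact mul_eq_zero_of_right _ h2
  obtain ⟨c, hc⟩ := ae_eq_const_of_weak_fderiv_eq_zero Ω.isOpen hΩc.isPreconnected π.2.1 hgrad
  rw [← ae_restrict_iff' Ω.isOpen.measurableSet] at hc
  -- The mean-zero condition reads `|Ω| c = 0`, and `Ω` has positive finite measure.
  have hc0 : c = 0 := by
    have h1 := π.2.2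
    rw [integral_congr_ae hc, setIntegral_const, smul_eq_mul, mul_eq_zero] at h1
    refine h1.resolve_left ?_
    rw [measureReal_def, ENNReal.toReal_eq_zero_iff, not_or]
    exact ⟨(Ω.isOpen.measure_pos volume hΩc.nonempty).ne', hΩb.measure_lt_top.ne⟩
  apply Subtype.ext
  change (π : L2 (Ω : Set (E N))) = 0
  rw [Lp.eq_zero_iff_ae_eq_zero]
  filter_upwards [hc] with x hx
  rw [hx, hc0]
  rfl

/-- The map `π ↦ (g ↦ ∫_Ω π ∂_k g^k)` from `L²(Ω)/ℝ` to `H⁻¹(Ω)^N`. -/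
def pressureL (Ω : Opens (E N)) (k : Fin N) : L2mod Ω →L[ℝ] Hneg1N Ω :=
  (innerSL ℝ).bilinearComp (L2mod Ω).subtypeL (pdL Ω k k)

/-- The fundamental lemma of the calculus of variations on `]0,T[` for vector-valued functions. -/
theorem ae_clm_eq_zero_of_timeInt_eq_zero {X Y : Type} [NormedAddCommGroup X] [NormedSpace ℝ X]
    [CompleteSpace X] [NormedAddCommGroup Y] [NormedSpace ℝ Y] [CompleteSpace Y] (L : X →L[ℝ] Y)
    {P : L2T T X} (h : ∀ φ : 𝓓(timeInterval T, ℝ), L (timeInt φ P) = 0) :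
    ∀ᵐ t ∂(volume.restrict (Ioo 0 T)), L (P t) = 0 := by
  rw [ae_restrict_iff' measurableSet_Ioo]
  have h1 : IntegrableOn (fun t => L (P t)) (Ioo 0 T) := L.integrable_comp (L2T.integrable P)
  refine isOpen_Ioo.ae_eq_zero_of_integral_contDiff_smul_eq_zero h1.locallyIntegrableOn
    fun η hη hηc hηs => ?_
  rw [← setIntegral_eq_integral_of_forall_compl_eq_zero (s := Ioo 0 T) fun t ht => by
    rw [Function.notMem_support.1 fun hs => ht (hηs (subset_tsupport _ hs)), zero_smul]]
  rw [clm_timeInt L P hη.continuous hηc]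
  exact h ⟨η, hη, hηc, hηs⟩

/-- The variational lemma is applied to `t ↦ B (P t)` with values in the dual of `H`, so the
exceptional null set does not depend on `g`. -/
theorem ae_bilin_eq_zero_of_timeInt_eq_zero {X H : Type} [NormedAddCommGroup X] [NormedSpace ℝ X]
    [CompleteSpace X] [NormedAddCommGroup H] [NormedSpace ℝ H] (B : X →L[ℝ] H →L[ℝ] ℝ)
    {P : L2T T X} (h : ∀ (φ : 𝓓(timeInterval T, ℝ)) (g : H), B (timeInt φ P) g = 0) :
    ∀ᵐ t ∂(volume.restrict (Ioo 0 T)), ∀ g, B (P t) g = 0 := by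
  filter_upwards [ae_clm_eq_zero_of_timeInt_eq_zero B fun φ => ContinuousLinearMap.ext (h φ)]
    with t ht g
  rw [ht, _root_.zero_apply]

theorem pressure_eq_zero (hΩb : Bornology.IsBounded (Ω : Set (E N)))
    (hΩc : IsConnected (Ω : Set (E N))) {P : L2T T (L2mod Ω)}
    (h : ∀ (φ : 𝓓(timeInterval T, ℝ)) (k : Fin N) (g : H10 Ω),
      inner ℝ ((timeInt φ P : L2mod Ω) : L2 (Ω : Set (E N)))
        (coord (g : H1Amb (Ω : Set (E N))) (some k)) = 0) : P = 0 := by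
  have : CompleteSpace (L2mod Ω) := (isClosed_L2mod hΩb).completeSpace_coe
  have hk : ∀ k, ∀ᵐ t ∂(volume.restrict (Ioo 0 T)), ∀ g, pressureL Ω k (P t) g = 0 := fun k =>
    ae_bilin_eq_zero_of_timeInt_eq_zero (pressureL Ω k) fun φ g => h φ k (g k)
  rw [Lp.eq_zero_iff_ae_eq_zero]
  filter_upwards [ae_all_iff.2 hk] with t ht
  refine L2mod_eq_zero hΩb hΩc fun η k => ?_
  -- Only the `k`-th component enters `pressureL Ω k`, so the others may be chosen arbitrarily.
  exact ht k (WithLp.toLp 2 fun _ => testH10 η)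

end Pressure

/-! ### Difference of two solutions -/

section Uniqueness

variable {N : ℕ} {Ω : Opens (E N)} {T : ℝ}

theorem comp_sub (v v' : H10N Ω) (k : Fin N) : comp (v - v') k = comp v k - comp v' k := rfl

theorem VanishesAtZero.sub {u u' : L2T T (V Ω)} (h : VanishesAtZero Ω T u)
    (h' : VanishesAtZero Ω T u') : VanishesAtZero Ω T (u - u') := by
  obtain ⟨w, hw, hwu, hw0⟩ := h
  obtain ⟨w', hw', hwu', hw0'⟩ := h'
  refine ⟨w - w', hw.sub hw', ?_, by simp [hw0, hw0']⟩
  filter_upwards [hwu, hwu', Lp.coeFn_sub u u'] with t h1 h2 h3 k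
  have h4 : (u - u' : L2T T (V Ω)) t = u t - u' t := h3
  rw [h4, Submodule.coe_sub, comp_sub, ← h1 k, ← h2 k]
  rfl

theorem timeInt_zero {X : Type} [NormedAddCommGroup X] [NormedSpace ℝ X] (θ : ℝ → ℝ) :
    timeInt θ (0 : L2T T X) = 0 := by
  rw [timeInt]
  refine integral_eq_zero_of_ae ?_
  filter_upwards [Lp.coeFn_zero X 2 (volume.restrict (Ioo (0 : ℝ) T))] with t ht
  rw [ht]
  simp

end Uniqueness

end

end StokesHom

open StokesHom
theorem lemma3p3 {N : ℕ} (hN : 0 < N)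
    (Ω : Opens (E N)) (hΩb : Bornology.IsBounded (Ω : Set (E N)))
    (hΩc : IsConnected (Ω : Set (E N)))
    {T : ℝ} (hT : 0 < T)
    (a : Fin N → Fin N → E N → ℝ)
    (ha_bdd : ∀ i j, MemLp (a i j) ∞ (volume : Measure (E N)))
    (ha_symm : ∀ i j, ∀ᵐ y : E N, a i j y = a j i y)
    {α : ℝ} (hα : 0 < α)
    (ha_ell : ∀ᵐ y : E N, ∀ ζ : E N, α * ‖ζ‖ ^ 2 ≤ ∑ i, ∑ j, a i j y * ζ j * ζ i)
    (ha_per : ∀ i j, IsYPeriodic (a i j))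
    (f : L2T T (Hneg1N Ω))
    (u u' : L2T T (V Ω)) (p p' : L2T T (L2mod Ω))
    (h : IsWeakSolution Ω T a f u p) (h' : IsWeakSolution Ω T a f u' p') :
    u = u' ∧ p = p' := by
  have hell : ∀ᵐ y : E N, ∀ ζ : E N, 0 ≤ ∑ i, ∑ j, a i j y * ζ j * ζ i := by
    filter_upwards [ha_ell] with y hy ζ
    exact le_trans (by positivity) (hy ζ)
  obtain ⟨w, hw, hwU, hw0⟩ := h.initial.sub h'.initial
  have heq := fun φ => h.weakLHS_sub_eq_zero h' hΩb φ
  have hU : u - u' = 0 := eq_zero_of_weak_equation hT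
    (formL_self_nonneg (sum_q_nonneg ha_bdd hell)) (fun v φ => massL_timeInt_deriv (heq φ) v)
    hw hw0 hwU
  refine ⟨sub_eq_zero.1 hU, sub_eq_zero.1 (pressure_eq_zero hΩb hΩc fun φ k g => ?_)⟩
  have h1 := heq φ k g
  -- With zero velocity only the pressure term survives, for every `g ∈ H₀¹(Ω)`.
  rw [hU, timeInt_zero, timeInt_zero, weakLHS, ← qL_apply, ← compL_apply] at h1
  simpa using h1
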